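/- Let $G$ be a finite simple 2-connected graph on $n$ vertices (that is, $n\ge 3$, $G$ is connected, and $G-v$ is connected for every vertex $v$). The rainbow connection number $\mathrm{rc}(G)$ is the least number of colours in a (not necessarily proper) colouring of the edges of $G$ such that every two vertices are joined by a path no two of whose edges have the same colour. Then $$\mathrm{rc}(G)\le\left\lceil \frac n2\right\rceil .$$ Moreover, the bound is attained by the odd cycles of length at least 5: $\mathrm{rc}(C_n)=\lceil n/2\rceil$ for every odd $n\ge 5$. -/

import Mathlib

namespace SimpleGraph

/-- A graph is 2-connected if it has at least three vertices, is connected, and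
stays connected after the deletion of any single vertex. -/
structure IsTwoConnected {V : Type*} (G : SimpleGraph V) : Prop where
  three_le_card : 3 ≤ ENat.card V
  connected : G.Connected
  connected_delete : ∀ v : V, (G.induce {v}ᶜ).Connected

/-- A walk is rainbow under an edge-colouring (not necessarily proper) if no two distinct
edges of it have the same colour. -/
def EdgeLabeling.IsRainbow {V K : Type*} {G : SimpleGraph V} (c : G.EdgeLabeling K)
    {u v : V} (p : G.Walk u v) : Prop :=
  ∀ e f : G.edgeSet, (e : Sym2 V) ∈ p.edges → (f : Sym2 V) ∈ p.edges → c e = c f → e = f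

/-- An edge-colouring is rainbow-connecting if every two vertices are joined by a rainbow path. -/
def EdgeLabeling.IsRainbowConnecting {V K : Type*} {G : SimpleGraph V}
    (c : G.EdgeLabeling K) : Prop :=
  ∀ u v : V, ∃ p : G.Walk u v, p.IsPath ∧ c.IsRainbow p

/-- The rainbow connection number: the least `k` such that some edge-colouring with colours
from a set of size `k` is rainbow-connecting (`⊤` if there is no such `k`). -/
noncomputable def rainbowConnectionNumber {V : Type*} (G : SimpleGraph V) : ℕ∞ :=
  ⨅ (k : ℕ) (_ : ∃ c : G.EdgeLabeling (Fin k), c.IsRainbowConnecting), (k : ℕ∞)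

end SimpleGraph

namespace SimpleGraph

variable {V : Type*} {G : SimpleGraph V}

/-- `G.RainbowReach c S A u v`: some walk from `u` to `v` inside `S` has edges of pairwise distinct
colours, all of them in `A`. -/
def RainbowReach (G : SimpleGraph V) (c : Sym2 V → ℕ) (S : Set V) (A : Set ℕ) (u v : V) : Prop :=
  ∃ p : G.Walk u v, (∀ w ∈ p.support, w ∈ S) ∧ (p.edges.map c).Nodup ∧ ∀ e ∈ p.edges, c e ∈ A

namespace RainbowReach

variable {c c' : Sym2 V → ℕ} {S T : Set V} {A B C : Set ℕ} {u v w : V}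

theorem refl (hu : u ∈ S) : G.RainbowReach c S A u u := ⟨.nil, by simpa using hu, by simp, by simp⟩

theorem mono (h : G.RainbowReach c S A u v) (hAB : A ⊆ B) : G.RainbowReach c S B u v := by
  obtain ⟨p, h1, h2, h3⟩ := h
  exact ⟨p, h1, h2, fun e he => hAB (h3 e he)⟩

theorem symm (h : G.RainbowReach c S A u v) : G.RainbowReach c S A v u := by
  obtain ⟨p, h1, h2, h3⟩ := h
  refine ⟨p.reverse, by simpa using h1, ?_, by simpa using h3⟩
  rw [Walk.edges_reverse, List.map_reverse]
  exact List.nodup_reverse.2 h2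

theorem trans (h : G.RainbowReach c S A u v) (h' : G.RainbowReach c S B v w)
    (hAB : Disjoint A B) (hA : A ⊆ C) (hB : B ⊆ C) : G.RainbowReach c S C u w := by
  obtain ⟨p, h1, h2, h3⟩ := h
  obtain ⟨q, h1', h2', h3'⟩ := h'
  refine ⟨p.append q, ?_, ?_, ?_⟩
  · intro x hx
    rw [Walk.mem_support_append_iff] at hx
    exact hx.elim (h1 x) (h1' x)
  · rw [Walk.edges_append, List.map_append, List.nodup_append]
    refine ⟨h2, h2', ?_⟩
    intro a ha b hb hab
    simp only [List.mem_map] at ha hb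
    obtain ⟨e, he, rfl⟩ := ha
    obtain ⟨e', he', rfl⟩ := hb
    exact Set.disjoint_left.1 hAB (h3 e he) (hab ▸ h3' e' he')
  · intro e he
    rw [Walk.edges_append, List.mem_append] at he
    exact he.elim (fun h => hA (h3 e h)) (fun h => hB (h3' e h))

theorem of_adj (h : G.Adj u v) (hu : u ∈ S) (hv : v ∈ S) (hc : c s(u, v) ∈ A) :
    G.RainbowReach c S A u v :=
  ⟨.cons h .nil, by simp [hu, hv], by simp, by simpa using hc⟩

theorem of_agree (h : G.RainbowReach c S A u v) (hST : S ⊆ T)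
    (hc : ∀ x ∈ S, ∀ y ∈ S, c' s(x, y) = c s(x, y)) : G.RainbowReach c' T A u v := by
  obtain ⟨p, h1, h2, h3⟩ := h
  have key : ∀ e ∈ p.edges, c' e = c e := by
    intro e he
    induction e with
    | h x y => exact hc x (h1 x (p.fst_mem_support_of_mem_edges he)) y
                (h1 y (p.snd_mem_support_of_mem_edges he))
  refine ⟨p, fun x hx => hST (h1 x hx), ?_, fun e he => ?_⟩
  · rwa [List.map_congr_left key]
  · rw [key e he]; exact h3 e he

end RainbowReach

/-- The set `S'`, coloured by `c'` with colours in `O'`, arises from `S`, coloured by `c` with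
colours in `O`, by adding the ear `x 0, …, x L`, whose `i`-th edge has colour `f i`; two edges of
the ear have the same colour if and only if their distance along the ear is `p`, and such edges
have colours outside `O`. -/
structure EarColoring (G : SimpleGraph V) (c c' : Sym2 V → ℕ) (S S' : Set V) (O O' : Set ℕ)
    (x : ℕ → V) (f : ℕ → ℕ) (L p : ℕ) : Prop where
  start_mem : x 0 ∈ S
  end_mem : x L ∈ S
  ends_ne : x 0 ≠ x L
  mem_iff : ∀ v, v ∈ S' ↔ v ∈ S ∨ ∃ i, 0 < i ∧ i < L ∧ x i = v
  old_reach : ∀ A u v, G.RainbowReach c S A u v → G.RainbowReach c' S' A u v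
  adj : ∀ i < L, G.Adj (x i) (x (i + 1))
  color : ∀ i < L, c' s(x i, x (i + 1)) = f i
  color_eq_iff : ∀ i < L, ∀ j < L, f i = f j ↔ i = j ∨ i = j + p ∨ j = i + p
  new : ∀ i < L, i + p < L ∨ p ≤ i → f i ∉ O
  subset : O ⊆ O'
  color_mem : ∀ i < L, f i ∈ O'
  period_le : p ≤ L
  le_two_mul : L ≤ 2 * p

namespace EarColoring

variable {c c' : Sym2 V → ℕ} {S S' : Set V} {O O' A B : Set ℕ} {x : ℕ → V} {f : ℕ → ℕ} {L p : ℕ}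
  {u v : V} {i j : ℕ}

theorem mem_old (E : EarColoring G c c' S S' O O' x f L p) (hv : v ∈ S) : v ∈ S' :=
  (E.mem_iff v).2 (.inl hv)

theorem mem_ear (E : EarColoring G c c' S S' O O' x f L p) (hi : i ≤ L) : x i ∈ S' := by
  rcases Nat.eq_zero_or_pos i with rfl | h0
  · exact E.mem_old E.start_mem
  rcases hi.eq_or_lt with rfl | h1
  · exact E.mem_old E.end_mem
  · exact (E.mem_iff _).2 (.inr ⟨i, h0, h1, rfl⟩)

theorem reverse (E : EarColoring G c c' S S' O O' x f L p) :
    EarColoring G c c' S S' O O' (fun i => x (L - i)) (fun i => f (L - 1 - i)) L p where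
  start_mem := E.end_mem
  end_mem := by simpa using E.start_mem
  ends_ne := by simpa using E.ends_ne.symm
  mem_iff v := by
    rw [E.mem_iff]
    refine or_congr_right ⟨?_, ?_⟩
    · rintro ⟨i, h0, h1, rfl⟩
      exact ⟨L - i, by omega, by omega, by congr 1; omega⟩
    · rintro ⟨i, h0, h1, rfl⟩
      exact ⟨L - i, by omega, by omega, rfl⟩
  old_reach := E.old_reach
  adj i hi := by
    have := (E.adj (L - 1 - i) (by omega)).symm
    rwa [show L - 1 - i + 1 = L - i by omega, show L - 1 - i = L - (i + 1) by omega] at this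
  color i hi := by
    have := E.color (L - 1 - i) (by omega)
    rwa [show L - 1 - i + 1 = L - i by omega, Sym2.eq_swap,
      show x (L - 1 - i) = x (L - (i + 1)) by congr 1; omega] at this
  color_eq_iff i hi j hj := by
    rw [E.color_eq_iff _ (by omega) _ (by omega)]
    omega
  new i hi h := E.new _ (by omega) (by omega)
  subset := E.subset
  color_mem i hi := E.color_mem _ (by omega)
  period_le := E.period_le
  le_two_mul := E.le_two_mul

theorem color_ne (E : EarColoring G c c' S S' O O' x f L p) (hi : i < L) (hj : j < L)
    (h : i ≠ j) (h' : i ≠ j + p) (h'' : j ≠ i + p) : f i ≠ f j := by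
  rw [Ne, E.color_eq_iff i hi j hj]
  omega

theorem along (E : EarColoring G c c' S S' O O' x f L p) (hij : i ≤ j) (hj : j ≤ L)
    (hp : j ≤ i + p) : G.RainbowReach c' S' (f '' Set.Ico i j) (x i) (x j) := by
  induction j, hij using Nat.le_induction with
  | base => exact .refl (E.mem_ear hj)
  | succ j hij ih =>
    refine (ih (by omega) (by omega)).trans (B := {f j})
      (.of_adj (E.adj j (by omega)) (E.mem_ear (by omega)) (E.mem_ear hj) (E.color j (by omega)))
      ?_ ?_ ?_
    · rw [Set.disjoint_singleton_right]
      rintro ⟨s, ⟨hs, hs'⟩, h⟩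
      exact E.color_ne (by omega) (by omega) (by omega) (by omega) (by omega) h
    · exact Set.image_mono (Set.Ico_subset_Ico_right (by omega))
    · rw [Set.singleton_subset_iff]
      exact ⟨j, ⟨hij, by omega⟩, rfl⟩

/-- Going from `x i` back to the start of the ear and on through `S`. -/
theorem back (E : EarColoring G c c' S S' O O' x f L p) (hi : i ≤ p) (hv : G.RainbowReach c S B (x 0) v)
    (hB : ∀ s < i, f s ∉ B) :
    G.RainbowReach c' S' (B ∪ f '' Set.Iio i) (x i) v := by
  refine ((E.along (Nat.zero_le i) (hi.trans E.period_le) (by omega)).symm).trans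
    (E.old_reach _ _ _ hv) ?_ ?_ Set.subset_union_left
  · rw [Set.disjoint_left]
    rintro _ ⟨s, ⟨-, hs⟩, rfl⟩
    exact hB s hs
  · refine Set.Subset.trans (Set.image_mono ?_) Set.subset_union_right
    exact fun s hs => hs.2

theorem forth (E : EarColoring G c c' S S' O O' x f L p) (hi : L ≤ i + p) (hi' : i ≤ L)
    (hv : G.RainbowReach c S B (x L) v) (hB : ∀ s < L, i ≤ s → f s ∉ B) :
    G.RainbowReach c' S' (B ∪ f '' Set.Ico i L) (x i) v := by
  refine (E.along hi' le_rfl hi).trans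
    (E.old_reach _ _ _ hv) ?_ Set.subset_union_right Set.subset_union_left
  · rw [Set.disjoint_left]
    rintro _ ⟨s, ⟨hs, hs'⟩, rfl⟩
    exact hB s hs' hs

/-- Going between two ear vertices through `S`. -/
theorem around (E : EarColoring G c c' S S' O O' x f L p) (hij : i + p ≤ j) (hj : j ≤ L)
    (hB : B ⊆ O) (h : G.RainbowReach c S B (x 0) (x L)) :
    G.RainbowReach c' S' (B ∪ f '' (Set.Iio i ∪ Set.Ico j L)) (x i) (x j) := by
  have h2 := E.le_two_mul
  refine (E.back (by omega) h ?_).trans (E.along hj le_rfl (by omega)).symm ?_ ?_ ?_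
  · exact fun s hs hs' => E.new s (by omega) (by omega) (hB hs')
  · rw [Set.disjoint_left]
    rintro _ (h | ⟨s, hs, rfl⟩) ⟨s', ⟨hs', hs''⟩, h'⟩
    · exact E.new s' hs'' (by omega) (hB (h' ▸ h))
    · simp only [Set.mem_Iio] at hs
      exact E.color_ne (by omega) (by omega) (by omega) (by omega) (by omega) h'
  · exact Set.union_subset_union_right _ (Set.image_mono Set.subset_union_left)
  · exact Set.Subset.trans (Set.image_mono Set.subset_union_right) Set.subset_union_right

theorem subset_all (E : EarColoring G c c' S S' O O' x f L p) {T : Set ℕ} (hB : B ⊆ O)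
    (hT : ∀ s ∈ T, s < L) : B ∪ f '' T ⊆ O' := by
  rintro _ (h | ⟨s, hs, rfl⟩)
  exacts [E.subset (hB h), E.color_mem s (hT s hs)]

theorem subset_diff_pair (E : EarColoring G c c' S S' O O' x f L p) {T : Set ℕ} {γ δ : ℕ}
    (hB : B ⊆ O) (hT : ∀ s ∈ T, s < L) (hγ : γ ∉ B) (hδ : δ ∉ B)
    (hγ' : ∀ s ∈ T, f s ≠ γ) (hδ' : ∀ s ∈ T, f s ≠ δ) : B ∪ f '' T ⊆ O' \ {γ, δ} := by
  rintro _ (h | ⟨s, hs, rfl⟩)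
  · refine ⟨E.subset (hB h), ?_⟩
    rintro (rfl | rfl)
    exacts [hγ h, hδ h]
  · refine ⟨E.color_mem s (hT s hs), ?_⟩
    rintro (h | h)
    exacts [hγ' s hs h, hδ' s hs h]

end EarColoring

/-- Some rainbow walk from `u` to `v` inside `S` misses a colour of `O`. -/
def NonFull (G : SimpleGraph V) (c : Sym2 V → ℕ) (S : Set V) (O : Set ℕ) (u v : V) : Prop :=
  ∃ γ ∈ O, G.RainbowReach c S (O \ {γ}) u v

/-- Some rainbow walk from `u` to `v` inside `S` misses the colour `α` and another colour of `O`. -/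
def TwoMissing (G : SimpleGraph V) (c : Sym2 V → ℕ) (S : Set V) (O : Set ℕ) (α : ℕ) (u v : V) :
    Prop :=
  ∃ δ ∈ O, δ ≠ α ∧ G.RainbowReach c S (O \ {α, δ}) u v

/-- For suitable distinct colours `α`, `β`, every vertex of `S` is reached from `a` without `α` or
from `b` without `β`, and for all vertices but one a second colour can be avoided as well. -/
def Cover (G : SimpleGraph V) (c : Sym2 V → ℕ) (S : Set V) (O : Set ℕ) (a b : V) : Prop :=
  ∃ α ∈ O, ∃ β ∈ O, α ≠ β ∧ ∃ v₀, ∀ v ∈ S, G.TwoMissing c S O α a v ∨ G.TwoMissing c S O β b v ∨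
    (v = v₀ ∧ (G.RainbowReach c S (O \ {α}) a v ∨ G.RainbowReach c S (O \ {β}) b v))

/-- Every two vertices of `S` are joined by a rainbow walk, and for every vertex there is at most
one other vertex for which all these walks use all colours. -/
structure IsMatched (G : SimpleGraph V) (c : Sym2 V → ℕ) (S : Set V) (O : Set ℕ) : Prop where
  nonempty : O.Nonempty
  reach : ∀ u ∈ S, ∀ v ∈ S, G.RainbowReach c S O u v
  unique : ∀ u ∈ S, ∀ v ∈ S, ∀ w ∈ S, ¬ G.NonFull c S O u v → ¬ G.NonFull c S O u w → v = w

/-- Every two vertices of `S` are joined by a rainbow walk missing a colour, and cover `S` in the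
sense of `SimpleGraph.Cover`. -/
structure IsFlexible (G : SimpleGraph V) (c : Sym2 V → ℕ) (S : Set V) (O : Set ℕ) : Prop where
  exists_two : ∀ μ, ∃ o ∈ O, ∃ o' ∈ O, o ≠ μ ∧ o' ≠ μ ∧ o ≠ o'
  nonFull : ∀ u ∈ S, ∀ v ∈ S, G.NonFull c S O u v
  cover : ∀ a ∈ S, ∀ b ∈ S, a ≠ b → G.Cover c S O a b

section

variable {c : Sym2 V → ℕ} {S : Set V} {O : Set ℕ} {u v a b : V} {α : ℕ}

theorem NonFull.symm (h : G.NonFull c S O u v) : G.NonFull c S O v u := by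
  obtain ⟨γ, hγ, h⟩ := h
  exact ⟨γ, hγ, h.symm⟩

theorem NonFull.reach (h : G.NonFull c S O u v) : G.RainbowReach c S O u v := by
  obtain ⟨γ, hγ, h⟩ := h
  exact h.mono Set.sdiff_subset

theorem Cover.symm (h : G.Cover c S O a b) : G.Cover c S O b a := by
  obtain ⟨α, hα, β, hβ, hne, v₀, h⟩ := h
  refine ⟨β, hβ, α, hα, hne.symm, v₀, fun v hv => ?_⟩
  rcases h v hv with h | h | ⟨h, h' | h'⟩
  exacts [.inr (.inl h), .inl h, .inr (.inr ⟨h, .inr h'⟩), .inr (.inr ⟨h, .inl h'⟩)]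

theorem RainbowReach.single (h : G.RainbowReach c S (O \ {α, α}) u v) :
    G.RainbowReach c S (O \ {α}) u v := by
  simpa using h

end

namespace EarColoring

variable {c c' : Sym2 V → ℕ} {S S' : Set V} {O O' A B : Set ℕ} {x : ℕ → V} {f : ℕ → ℕ} {L p : ℕ}
  {u v w : V} {i j k γ δ : ℕ}

theorem along_avoiding (E : EarColoring G c c' S S' O O' x f L p) (hij : i ≤ j) (hj : j ≤ L)
    (hp : j ≤ i + p) (h : ∀ s, i ≤ s → s < j → f s ≠ γ ∧ f s ≠ δ) :
    G.RainbowReach c' S' (O' \ {γ, δ}) (x i) (x j) :=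
  (E.along hij hj hp).mono <| by
    simpa using E.subset_diff_pair (B := ∅) (T := Set.Ico i j) (Set.empty_subset _)
      (fun s hs => lt_of_lt_of_le hs.2 hj) (Set.notMem_empty _) (Set.notMem_empty _)
      (fun s hs => (h s hs.1 hs.2).1) (fun s hs => (h s hs.1 hs.2).2)

theorem old_avoiding (E : EarColoring G c c' S S' O O' x f L p) (hB : B ⊆ O) (hγ : γ ∉ B)
    (hδ : δ ∉ B) (h : G.RainbowReach c S B u v) : G.RainbowReach c' S' (O' \ {γ, δ}) u v :=
  (E.old_reach _ _ _ h).mono <| by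
    simpa using E.subset_diff_pair (T := ∅) hB (by simp) hγ hδ (by simp) (by simp)

theorem back_avoiding (E : EarColoring G c c' S S' O O' x f L p) (hi : i ≤ p) (hB : B ⊆ O)
    (hγ : γ ∉ B) (hδ : δ ∉ B) (hv : G.RainbowReach c S B (x 0) v)
    (h : ∀ s < i, f s ∉ B ∧ f s ≠ γ ∧ f s ≠ δ) :
    G.RainbowReach c' S' (O' \ {γ, δ}) (x i) v :=
  (E.back hi hv fun s hs => (h s hs).1).mono <|
    E.subset_diff_pair hB (fun s hs => by have := E.period_le; have : s < i := hs; omega) hγ hδ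
      (fun s hs => (h s hs).2.1) (fun s hs => (h s hs).2.2)

theorem forth_avoiding (E : EarColoring G c c' S S' O O' x f L p) (hi : L ≤ i + p) (hi' : i ≤ L)
    (hB : B ⊆ O) (hγ : γ ∉ B) (hδ : δ ∉ B) (hv : G.RainbowReach c S B (x L) v)
    (h : ∀ s < L, i ≤ s → f s ∉ B ∧ f s ≠ γ ∧ f s ≠ δ) :
    G.RainbowReach c' S' (O' \ {γ, δ}) (x i) v :=
  (E.forth hi hi' hv fun s hs hs' => (h s hs hs').1).mono <|
    E.subset_diff_pair hB (fun _ hs => hs.2) hγ hδ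
      (fun s hs => (h s hs.2 hs.1).2.1) (fun s hs => (h s hs.2 hs.1).2.2)

theorem around_avoiding (E : EarColoring G c c' S S' O O' x f L p) (hij : i + p ≤ j) (hj : j ≤ L)
    (hB : B ⊆ O) (hγ : γ ∉ B) (hδ : δ ∉ B) (h : G.RainbowReach c S B (x 0) (x L))
    (h' : ∀ s < L, s < i ∨ j ≤ s → f s ≠ γ ∧ f s ≠ δ) :
    G.RainbowReach c' S' (O' \ {γ, δ}) (x i) (x j) := by
  have hT : ∀ s ∈ Set.Iio i ∪ Set.Ico j L, s < L ∧ (s < i ∨ j ≤ s) := by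
    rintro s (hs | hs)
    · have : s < i := hs
      omega
    · exact ⟨hs.2, .inr hs.1⟩
  exact (E.around hij hj hB h).mono <| E.subset_diff_pair hB (fun s hs => (hT s hs).1) hγ hδ
      (fun s hs => (h' s (hT s hs).1 (hT s hs).2).1) (fun s hs => (h' s (hT s hs).1 (hT s hs).2).2)

theorem nonFull_of_lt (E : EarColoring G c c' S S' O O' x f L p) (hij : i ≤ j) (hj : j < L)
    (hp : j < i + p) : G.NonFull c' S' O' (x i) (x j) :=
  ⟨f j, E.color_mem j hj, .single <| E.along_avoiding hij hj.le hp.le fun s hs hs' =>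
    have := E.color_ne (i := s) (j := j) (by omega) hj (by omega) (by omega) (by omega)
    ⟨this, this⟩⟩

theorem nonFull_of_gt (E : EarColoring G c c' S S' O O' x f L p) (hij : i + p < j) (hj : j ≤ L)
    (h : G.RainbowReach c S O (x 0) (x L)) : G.NonFull c' S' O' (x i) (x j) := by
  have h2 := E.le_two_mul
  have hi := E.new i (by omega) (by omega)
  refine ⟨f i, E.color_mem i (by omega), .single <| E.around_avoiding hij.le hj subset_rfl hi hi h
    fun s hs hs' => ?_⟩
  have := E.color_ne (i := s) (j := i) (by omega) (by omega) (by omega) (by omega) (by omega)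
  exact ⟨this, this⟩

/-- A symmetric relation on `S'` may be checked on pairs of old vertices, on an ear vertex and an
old one, and on ear vertices in the order of the ear. -/
theorem pairs (E : EarColoring G c c' S S' O O' x f L p) {P : V → V → Prop}
    (symm : ∀ u v, P u v → P v u) (old : ∀ u ∈ S, ∀ v ∈ S, u ≠ v → P u v)
    (mixed : ∀ i, 0 < i → i < L → ∀ v ∈ S, P (x i) v)
    (ear : ∀ i j, 0 < i → i < j → j < L → P (x i) (x j)) :
    ∀ u ∈ S', ∀ v ∈ S', u ≠ v → P u v := by
  intro u hu v hv huv
  rcases (E.mem_iff u).1 hu with hu | ⟨i, hi, hi', rfl⟩ <;>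
    rcases (E.mem_iff v).1 hv with hv | ⟨j, hj, hj', rfl⟩
  · exact old u hu v hv huv
  · exact symm _ _ (mixed j hj hj' u hu)
  · exact mixed i hi hi' v hv
  · rcases lt_trichotomy i j with h | rfl | h
    · exact ear i j hi h hj'
    · exact absurd rfl huv
    · exact symm _ _ (ear j i hj h hi')

/-- An ear with an even number of inner vertices preserves `IsMatched`. -/
theorem isMatched_of_even (E : EarColoring G c c' S S' O O' x f L p) (hL : L + 1 = 2 * p)
    (hp : 2 ≤ p) (M : G.IsMatched c S O) : G.IsMatched c' S' O' := by
  have h00 := E.new 0 (by omega) (by omega)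
  have h0' := E.color_mem 0 (by omega)
  have hsub : ∀ T, (∀ s ∈ T, s < L) → O ∪ f '' T ⊆ O' := fun T => E.subset_all subset_rfl
  have hends := M.reach _ E.start_mem _ E.end_mem
  have old : ∀ u ∈ S, ∀ v ∈ S, G.NonFull c' S' O' u v := fun u hu v hv =>
    ⟨f 0, h0', .single <| E.old_avoiding subset_rfl h00 h00 (M.reach u hu v hv)⟩
  have key : ∀ {x f}, EarColoring G c c' S S' O O' x f L p → ∀ i, 0 < i → i < p → ∀ v ∈ S,
      G.RainbowReach c' S' O' (x i) v ∧
      (i = p - 1 ∧ ¬ G.NonFull c S O (x 0) v ∨ G.NonFull c' S' O' (x i) v) := by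
    intro x f E i hi hi' v hv
    have hv' := M.reach _ E.start_mem v hv
    refine ⟨(E.back hi'.le hv' fun s hs => E.new s (by omega) (by omega)).mono
      (E.subset_all subset_rfl fun s hs => ?_), ?_⟩
    · have : s < i := hs
      omega
    by_cases hip : i = p - 1
    · by_cases hN : G.NonFull c S O (x 0) v
      · obtain ⟨γ, hγ, hN⟩ := hN
        refine .inr ⟨γ, E.subset hγ, .single <| E.back_avoiding hi'.le Set.sdiff_subset
          (by simp) (by simp) hN fun s hs => ?_⟩
        have := E.new s (by omega) (by omega)
        have h2 : f s ≠ γ := fun h => this (h ▸ hγ)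
        exact ⟨fun h => this h.1, h2, h2⟩
      · exact .inl ⟨hip, hN⟩
    · have hn := E.new i (by omega) (by omega)
      refine .inr ⟨f i, E.color_mem i (by omega), .single <| E.back_avoiding hi'.le subset_rfl
        hn hn hv' fun s hs => ?_⟩
      have := E.color_ne (i := s) (j := i) (by omega) (by omega) (by omega) (by omega) (by omega)
      exact ⟨E.new s (by omega) (by omega), this, this⟩
  have mixed : ∀ i, 0 < i → i < L → ∀ v ∈ S, G.RainbowReach c' S' O' (x i) v ∧
      (i = p - 1 ∧ ¬ G.NonFull c S O (x 0) v ∨ i = p ∧ ¬ G.NonFull c S O (x L) v ∨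
        G.NonFull c' S' O' (x i) v) := by
    intro i hi hi' v hv
    rcases lt_or_ge i p with h | h
    · have := key E i hi h v hv
      tauto
    · have := key E.reverse (L - i) (by omega) (by omega) v hv
      simp only [Nat.sub_sub_self hi'.le, Nat.sub_zero] at this
      refine ⟨this.1, this.2.elim (fun h => .inr (.inl ⟨by omega, h.2⟩)) (fun h => .inr (.inr h))⟩
  have ear : ∀ i j, 0 < i → i < j → j < L → G.RainbowReach c' S' O' (x i) (x j) ∧
      (j = i + p ∨ G.NonFull c' S' O' (x i) (x j)) := by
    intro i j hi hij hj
    rcases lt_trichotomy j (i + p) with h | rfl | h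
    · have := E.nonFull_of_lt hij.le hj h
      exact ⟨this.reach, .inr this⟩
    · refine ⟨(E.along hij.le hj.le le_rfl).mono ?_, .inl rfl⟩
      rintro _ ⟨s, hs, rfl⟩
      exact E.color_mem s (hs.2.trans hj)
    · have := E.nonFull_of_gt h hj.le hends
      exact ⟨this.reach, .inr this⟩
  have refl : ∀ u ∈ S', G.NonFull c' S' O' u u := fun u hu => ⟨f 0, h0', .refl hu⟩
  refine ⟨⟨f 0, h0'⟩, fun u hu v hv => ?_, ?_⟩
  · by_cases huv : u = v
    · exact huv ▸ (refl u hu).reach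
    · exact E.pairs (P := fun u v => G.RainbowReach c' S' O' u v) (fun _ _ h => h.symm)
        (fun u hu v hv _ => (old u hu v hv).reach) (fun i hi hi' v hv => (mixed i hi hi' v hv).1)
        (fun i j hi hij hj => (ear i j hi hij hj).1) u hu v hv huv
  · have ear' : ∀ i j, 0 < i → i < L → 0 < j → j < L → ¬ G.NonFull c' S' O' (x i) (x j) →
        j = i + p ∨ i = j + p := by
      intro i j hi hi' hj hj' h
      rcases lt_trichotomy i j with h' | rfl | h'
      · exact .inl ((ear i j hi h' hj').2.resolve_right h)
      · exact absurd (refl _ (E.mem_ear hi'.le)) h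
      · exact .inr ((ear j i hj h' hi').2.resolve_right fun h'' => h h''.symm)
    have mixed' : ∀ i, 0 < i → i < L → ∀ v ∈ S, ¬ G.NonFull c' S' O' (x i) v →
        i = p - 1 ∧ ¬ G.NonFull c S O (x 0) v ∨ i = p ∧ ¬ G.NonFull c S O (x L) v := by
      intro i hi hi' v hv h
      have := (mixed i hi hi' v hv).2
      tauto
    intro u hu v hv w hw h1 h2
    rcases (E.mem_iff u).1 hu with hu | ⟨i, hi, hi', rfl⟩
    · rcases (E.mem_iff v).1 hv with hv | ⟨j, hj, hj', rfl⟩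
      · exact absurd (old u hu v hv) h1
      rcases (E.mem_iff w).1 hw with hw | ⟨k, hk, hk', rfl⟩
      · exact absurd (old u hu w hw) h2
      have hne := E.ends_ne
      have huniq : ∀ h1 : ¬ G.NonFull c S O (x 0) u, ¬ G.NonFull c S O (x L) u → False := fun h1 h2 =>
        hne (M.unique u hu _ E.start_mem _ E.end_mem (fun h => h1 h.symm) fun h => h2 h.symm)
      rcases mixed' j hj hj' u hu fun h => h1 h.symm with ⟨rfl, h3⟩ | ⟨rfl, h3⟩ <;>
        rcases mixed' k hk hk' u hu fun h => h2 h.symm with ⟨rfl, h4⟩ | ⟨rfl, h4⟩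
      exacts [rfl, (huniq h3 h4).elim, (huniq h4 h3).elim, rfl]
    · rcases (E.mem_iff v).1 hv with hv | ⟨j, hj, hj', rfl⟩ <;>
        rcases (E.mem_iff w).1 hw with hw | ⟨k, hk, hk', rfl⟩
      · rcases mixed' i hi hi' v hv h1 with ⟨h, h3⟩ | ⟨h, h3⟩ <;>
          rcases mixed' i hi hi' w hw h2 with ⟨h', h4⟩ | ⟨h', h4⟩
        · exact M.unique _ E.start_mem v hv w hw h3 h4
        · omega
        · omega
        · exact M.unique _ E.end_mem v hv w hw h3 h4
      · have := mixed' i hi hi' v hv h1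
        have := ear' i k hi hi' hk hk' h2
        omega
      · have := mixed' i hi hi' w hw h2
        have := ear' i j hi hi' hj hj' h1
        omega
      · have h3 := ear' i k hi hi' hk hk' h2
        have h4 := ear' i j hi hi' hj hj' h1
        congr 1
        omega

end EarColoring

theorem exists_two_of_three {O : Set ℕ} {o₁ o₂ o₃ : ℕ} (h₁ : o₁ ∈ O) (h₂ : o₂ ∈ O) (h₃ : o₃ ∈ O)
    (h₁₂ : o₁ ≠ o₂) (h₁₃ : o₁ ≠ o₃) (h₂₃ : o₂ ≠ o₃) (μ : ℕ) :
    ∃ o ∈ O, ∃ o' ∈ O, o ≠ μ ∧ o' ≠ μ ∧ o ≠ o' := by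
  by_cases h : o₁ = μ
  · exact ⟨o₂, h₂, o₃, h₃, fun h' => h₁₂ (h.trans h'.symm), fun h' => h₁₃ (h.trans h'.symm), h₂₃⟩
  · by_cases h' : o₂ = μ
    · exact ⟨o₁, h₁, o₃, h₃, h, fun h'' => h₂₃ (h'.trans h''.symm), h₁₃⟩
    · exact ⟨o₁, h₁, o₂, h₂, h, h', h₁₂⟩

namespace EarColoring

variable {c c' : Sym2 V → ℕ} {S S' : Set V} {O O' A B : Set ℕ} {x : ℕ → V} {f : ℕ → ℕ} {L p : ℕ}
  {u v w : V} {i j k γ δ : ℕ}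

theorem nonFull_of_odd (E : EarColoring G c c' S S' O O' x f L p) (hL : L = 2 * p)
    (hp : 2 ≤ p) (M : G.IsMatched c S O) : ∀ u ∈ S', ∀ v ∈ S', G.NonFull c' S' O' u v := by
  have h00 := E.new 0 (by omega) (by omega)
  have h0' := E.color_mem 0 (by omega)
  have hends := M.reach _ E.start_mem _ E.end_mem
  have key : ∀ {x f}, EarColoring G c c' S S' O O' x f L p → ∀ i, 0 < i → i < p → ∀ v ∈ S,
      G.NonFull c' S' O' (x i) v := by
    intro x f E i hi hi' v hv
    have hn := E.new i (by omega) (by omega)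
    refine ⟨f i, E.color_mem i (by omega), .single <| E.back_avoiding hi'.le subset_rfl
        hn hn (M.reach _ E.start_mem v hv) fun s hs => ?_⟩
    have := E.color_ne (i := s) (j := i) (by omega) (by omega) (by omega) (by omega) (by omega)
    exact ⟨E.new s (by omega) (by omega), this, this⟩
  have mid : ∀ {x f}, EarColoring G c c' S S' O O' x f L p → ∀ v ∈ S, G.NonFull c S O (x 0) v →
      G.NonFull c' S' O' (x p) v := by
    rintro x f E v hv ⟨γ, hγ, h⟩
    refine ⟨γ, E.subset hγ, .single <| E.back_avoiding le_rfl Set.sdiff_subset (by simp) (by simp)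
      h fun s hs => ?_⟩
    have := E.new s (by omega) (by omega)
    have h2 : f s ≠ γ := fun h => this (h ▸ hγ)
    exact ⟨fun h => this h.1, h2, h2⟩
  intro u hu v hv
  by_cases huv : u = v
  · exact ⟨f 0, h0', huv ▸ .refl hu⟩
  refine E.pairs (P := G.NonFull c' S' O') (fun _ _ h => h.symm) (fun u hu v hv _ =>
    ⟨f 0, h0', .single <| E.old_avoiding subset_rfl h00 h00 (M.reach u hu v hv)⟩) ?_ ?_ u hu v hv huv
  · intro i hi hi' v hv
    rcases lt_trichotomy i p with h | rfl | h
    · exact key E i hi h v hv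
    · by_cases h : G.NonFull c S O (x 0) v
      · exact mid E v hv h
      · by_cases h' : G.NonFull c S O (x L) v
        · have := mid E.reverse v hv (by simpa using h')
          rwa [show L - i = i by omega] at this
        · exact absurd (M.unique v hv _ E.start_mem _ E.end_mem (fun h1 => h h1.symm)
            fun h1 => h' h1.symm) E.ends_ne
    · have := key E.reverse (L - i) (by omega) (by omega) v hv
      simpa only [Nat.sub_sub_self hi'.le] using this
  · intro i j hi hij hj
    rcases lt_trichotomy j (i + p) with h | rfl | h
    · exact E.nonFull_of_lt hij.le hj h
    · obtain ⟨o, ho⟩ := M.nonempty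
      refine ⟨o, E.subset ho, .single <| E.along_avoiding hij.le hj.le le_rfl fun s hs hs' => ?_⟩
      have h2 : f s ≠ o := fun h => E.new s (by omega) (by omega) (h ▸ ho)
      exact ⟨h2, h2⟩
    · exact E.nonFull_of_gt h hj.le hends

/-- Both ends of the next ear are old vertices. -/
theorem cover_old_of_odd (E : EarColoring G c c' S S' O O' x f L p) (hL : L = 2 * p)
    (hp : 2 ≤ p) (M : G.IsMatched c S O) {a b : V} (hb : b ∈ S)
    (h₁ : G.NonFull c S O a (x L)) (h₂ : G.NonFull c S O b (x 0)) : G.Cover c' S' O' a b := by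
  obtain ⟨α, hα, h₁⟩ := h₁
  obtain ⟨γ, hγ, h₂⟩ := h₂
  have hnα : ∀ s < L, f s ≠ α := fun s hs h => E.new s hs (by omega) (h ▸ hα)
  have hnγ : ∀ s < L, f s ≠ γ := fun s hs h => E.new s hs (by omega) (h ▸ hγ)
  have hn : ∀ s < L, f s ∉ O := fun s hs => E.new s hs (by omega)
  have hm : ∀ s < L, f s ∈ O' := E.color_mem
  refine ⟨α, E.subset hα, f (p - 1), hm _ (by omega), (hnα _ (by omega)).symm, x p,
    fun v hv => ?_⟩
  rcases (E.mem_iff v).1 hv with hv | ⟨h, h0, hhL, rfl⟩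
  · exact .inr <| .inl ⟨f 0, hm _ (by omega), E.color_ne (by omega) (by omega) (by omega) (by omega)
      (by omega), E.old_avoiding subset_rfl (hn _ (by omega)) (hn _ (by omega)) (M.reach b hb v hv)⟩
  rcases lt_trichotomy h p with hhp | rfl | hhp
  · refine .inr <| .inl ⟨γ, E.subset hγ, (hnγ _ (by omega)).symm, .symm <| E.back_avoiding hhp.le
      Set.sdiff_subset (fun h => hn _ (by omega) h.1) (by simp) h₂.symm fun s hs =>
      ⟨fun h => hn s (by omega) h.1, ?_, hnγ s (by omega)⟩⟩
    exact E.color_ne (by omega) (by omega) (by omega) (by omega) (by omega)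
  · exact .inr <| .inr ⟨rfl, .inl <| .single <| .symm <| E.forth_avoiding (by omega) (by omega)
      Set.sdiff_subset (by simp) (by simp) h₁.symm fun s hs hs' =>
      ⟨fun h => hn s (by omega) h.1, hnα s hs, hnα s hs⟩⟩
  · refine .inl ⟨f 0, hm _ (by omega), hnα _ (by omega), .symm <| E.forth_avoiding (by omega)
      (by omega) Set.sdiff_subset (by simp) (fun h => hn _ (by omega) h.1) h₁.symm fun s hs hs' =>
      ⟨fun h => hn s (by omega) h.1, hnα s hs, ?_⟩⟩
    exact E.color_ne (by omega) (by omega) (by omega) (by omega) (by omega)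

/-- The next ear joins the middle of the ear to an old vertex. -/
theorem cover_mid_of_odd (E : EarColoring G c c' S S' O O' x f L p) (hL : L = 2 * p)
    (hp : 2 ≤ p) (M : G.IsMatched c S O) {b : V} (hb : b ∈ S) : G.Cover c' S' O' (x p) b := by
  obtain ⟨o, ho⟩ := M.nonempty
  have hno : ∀ s < L, f s ≠ o := fun s hs h => E.new s hs (by omega) (h ▸ ho)
  have hn : ∀ s < L, f s ∉ O := fun s hs => E.new s hs (by omega)
  have hm : ∀ s < L, f s ∈ O' := E.color_mem
  refine ⟨o, E.subset ho, f (p - 1), hm _ (by omega), (hno _ (by omega)).symm, b,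
    fun v hv => ?_⟩
  rcases (E.mem_iff v).1 hv with hv | ⟨h, h0, hhL, rfl⟩
  · exact .inr <| .inl ⟨f 0, hm _ (by omega), E.color_ne (by omega) (by omega) (by omega) (by omega)
      (by omega), E.old_avoiding subset_rfl (hn _ (by omega)) (hn _ (by omega)) (M.reach b hb v hv)⟩
  rcases le_total h p with hhp | hhp
  · refine .inl ⟨f 0, hm _ (by omega), hno _ (by omega), .symm <| E.along_avoiding hhp (by omega)
      (by omega) fun s hs hs' => ⟨hno s (by omega), ?_⟩⟩
    exact E.color_ne (by omega) (by omega) (by omega) (by omega) (by omega)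
  · refine .inl ⟨f (p - 1), hm _ (by omega), hno _ (by omega), E.along_avoiding hhp (by omega)
      (by omega) fun s hs hs' => ⟨hno s (by omega), ?_⟩⟩
    exact E.color_ne (by omega) (by omega) (by omega) (by omega) (by omega)

/-- The next ear starts at `x i` and ends at an old vertex, or far away from `x i` on the ear. -/
theorem cover_far_of_odd (E : EarColoring G c c' S S' O O' x f L p) (hL : L = 2 * p)
    (M : G.IsMatched c S O) (hi : 0 < i) (hip : i < p) {b : V}
    (hb : b ∈ S ∨ ∃ j, i + p < j ∧ j < L ∧ b = x j) : G.Cover c' S' O' (x i) b := by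
  obtain ⟨o, ho⟩ := M.nonempty
  have hno : ∀ s < L, f s ≠ o := fun s hs h => E.new s hs (by omega) (h ▸ ho)
  have hn : ∀ s < L, f s ∉ O := fun s hs => E.new s hs (by omega)
  have hm : ∀ s < L, f s ∈ O' := E.color_mem
  have hne : f 0 ≠ f i := E.color_ne (by omega) (by omega) (by omega) (by omega) (by omega)
  have hends := M.reach _ E.start_mem _ E.end_mem
  refine ⟨o, E.subset ho, f i, hm _ (by omega), (hno _ (by omega)).symm, x (i + p), fun v hv => ?_⟩
  rcases (E.mem_iff v).1 hv with hv | ⟨h, h0, hhL, rfl⟩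
  · refine .inr <| .inl ⟨f 0, hm _ (by omega), hne, ?_⟩
    rcases hb with hb | ⟨j, hj, hj', rfl⟩
    · exact E.old_avoiding subset_rfl (hn _ (by omega)) (hn _ (by omega)) (M.reach b hb v hv)
    · refine E.forth_avoiding (by omega) (by omega) subset_rfl (hn _ (by omega)) (hn _ (by omega))
        (M.reach _ E.end_mem v hv) fun s hs hs' => ⟨hn s hs, ?_, ?_⟩ <;>
      exact E.color_ne (by omega) (by omega) (by omega) (by omega) (by omega)
  rcases lt_trichotomy h i with hhi | rfl | hhi
  · refine .inr <| .inl ⟨f h, hm _ (by omega), E.color_ne (by omega) (by omega) (by omega)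
      (by omega) (by omega), .symm ?_⟩
    rcases hb with hb | ⟨j, hj, hj', rfl⟩
    · refine E.back_avoiding (by omega) subset_rfl (hn _ (by omega)) (hn _ (by omega))
        (M.reach _ E.start_mem b hb) fun s hs => ⟨hn s (by omega), ?_, ?_⟩ <;>
      exact E.color_ne (by omega) (by omega) (by omega) (by omega) (by omega)
    · refine E.around_avoiding (by omega) (by omega) subset_rfl (hn _ (by omega)) (hn _ (by omega))
        hends fun s hs hs' => ⟨?_, ?_⟩ <;>
      exact E.color_ne (by omega) (by omega) (by omega) (by omega) (by omega)
  · exact .inl ⟨f h, hm _ (by omega), hno _ (by omega), .refl (E.mem_ear hhL.le)⟩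
  rcases lt_trichotomy h (i + p) with hhp | rfl | hhp
  · refine .inl ⟨f h, hm _ (by omega), hno _ (by omega), E.along_avoiding hhi.le (by omega)
      (by omega) fun s hs hs' => ⟨hno s (by omega), ?_⟩⟩
    exact E.color_ne (by omega) (by omega) (by omega) (by omega) (by omega)
  · exact .inr <| .inr ⟨rfl, .inl <| .single <| E.along_avoiding hhi.le hhL.le le_rfl
      fun s hs hs' => ⟨hno s (by omega), hno s (by omega)⟩⟩
  rcases hb with hb | ⟨j, hj, hj', rfl⟩
  · refine .inr <| .inl ⟨f 0, hm _ (by omega), hne, .symm <| E.forth_avoiding (by omega) hhL.le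
      subset_rfl (hn _ (by omega)) (hn _ (by omega)) (M.reach _ E.end_mem b hb)
      fun s hs hs' => ⟨hn s (by omega), ?_, ?_⟩⟩ <;>
    exact E.color_ne (by omega) (by omega) (by omega) (by omega) (by omega)
  · refine .inr <| .inl ⟨o, E.subset ho, (hno _ (by omega)).symm, ?_⟩
    rcases le_total j h with hjh | hjh
    · refine E.along_avoiding hjh hhL.le (by omega) fun s hs hs' => ⟨?_, hno s (by omega)⟩
      exact E.color_ne (by omega) (by omega) (by omega) (by omega) (by omega)
    · refine .symm <| E.along_avoiding hjh hj'.le (by omega) fun s hs hs' => ⟨?_, hno s (by omega)⟩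
      exact E.color_ne (by omega) (by omega) (by omega) (by omega) (by omega)

/-- The next ear joins two vertices of the ear which are close to each other. -/
theorem cover_near_of_odd (E : EarColoring G c c' S S' O O' x f L p) (hL : L = 2 * p)
    (M : G.IsMatched c S O) (hi : 0 < i) (hip : i < p) (hij : i < j) (hj : j < L)
    (hjp : j ≤ i + p) : G.Cover c' S' O' (x i) (x j) := by
  obtain ⟨o, ho⟩ := M.nonempty
  have hno : ∀ s < L, f s ≠ o := fun s hs h => E.new s hs (by omega) (h ▸ ho)
  have hn : ∀ s < L, f s ∉ O := fun s hs => E.new s hs (by omega)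
  have hm : ∀ s < L, f s ∈ O' := E.color_mem
  have hends := M.reach _ E.start_mem _ E.end_mem
  obtain ⟨v₀, hv₀, hv₀'⟩ : ∃ v₀, (i + 1 = p → ∀ v ∈ S, v = v₀ ∨ G.NonFull c S O (x 0) v) ∧
      (i + 1 ≠ p → v₀ = x (i + p + 1)) := by
    by_cases hip' : i + 1 = p
    · by_cases h : ∃ v ∈ S, ¬ G.NonFull c S O (x 0) v
      · obtain ⟨v₀, h0, h1⟩ := h
        refine ⟨v₀, fun _ v hv => ?_, fun h => absurd hip' h⟩
        by_contra! h2
        exact h2.1 (M.unique _ E.start_mem v hv v₀ h0 h2.2 h1)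
      · push Not at h
        exact ⟨x 0, fun _ v hv => .inr (h v hv), fun h => absurd hip' h⟩
    · exact ⟨_, fun h => absurd h hip', fun _ => rfl⟩
  refine ⟨f i, hm _ (by omega), o, E.subset ho, hno _ (by omega), v₀, fun v hv => ?_⟩
  rcases (E.mem_iff v).1 hv with hv | ⟨h, h0, hhL, rfl⟩
  · by_cases hip' : i + 1 = p
    · rcases hv₀ hip' v hv with rfl | ⟨γ, hγ, h⟩
      · refine .inr <| .inr ⟨rfl, .inl <| .single <| E.back_avoiding hip.le subset_rfl
          (hn _ (by omega)) (hn _ (by omega)) (M.reach _ E.start_mem v hv) fun s hs => ?_⟩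
        have := E.color_ne (i := s) (j := i) (by omega) (by omega) (by omega) (by omega) (by omega)
        exact ⟨hn s (by omega), this, this⟩
      · have hnγ : ∀ s < L, f s ≠ γ := fun s hs h => hn s hs (h ▸ hγ)
        refine .inl ⟨γ, E.subset hγ, (hnγ _ (by omega)).symm, E.back_avoiding hip.le
          Set.sdiff_subset (fun h => hn _ (by omega) h.1) (by simp) h fun s hs =>
          ⟨fun h => hn s (by omega) h.1, ?_, hnγ s (by omega)⟩⟩
        exact E.color_ne (by omega) (by omega) (by omega) (by omega) (by omega)
    · refine .inl ⟨f (p - 1), hm _ (by omega), E.color_ne (by omega) (by omega) (by omega)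
        (by omega) (by omega), E.back_avoiding hip.le subset_rfl (hn _ (by omega)) (hn _ (by omega))
        (M.reach _ E.start_mem v hv) fun s hs => ⟨hn s (by omega), ?_, ?_⟩⟩ <;>
      exact E.color_ne (by omega) (by omega) (by omega) (by omega) (by omega)
  rcases le_or_gt h i with hhi | hhi
  · refine .inl ⟨o, E.subset ho, (hno _ (by omega)).symm, .symm <| E.along_avoiding hhi (by omega)
      (by omega) fun s hs hs' => ⟨?_, hno s (by omega)⟩⟩
    exact E.color_ne (by omega) (by omega) (by omega) (by omega) (by omega)
  rcases le_or_gt h (i + p) with hhp | hhp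
  · rcases le_total h j with hhj | hhj
    · refine .inr <| .inl ⟨f j, hm _ hj, hno _ hj, .symm <| E.along_avoiding hhj hj.le (by omega)
        fun s hs hs' => ⟨hno s (by omega), ?_⟩⟩
      exact E.color_ne (by omega) (by omega) (by omega) (by omega) (by omega)
    · refine .inr <| .inl ⟨f h, hm _ hhL, hno _ hhL, E.along_avoiding hhj hhL.le (by omega)
        fun s hs hs' => ⟨hno s (by omega), ?_⟩⟩
      exact E.color_ne (by omega) (by omega) (by omega) (by omega) (by omega)
  by_cases hh : h = i + p + 1
  · refine .inr <| .inr ⟨?_, .inl <| .single <| E.around_avoiding (by omega) hhL.le subset_rfl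
      (hn _ (by omega)) (hn _ (by omega)) hends fun s hs hs' => ?_⟩
    · rw [hv₀' (by omega), hh]
    · have := E.color_ne (i := s) (j := i) (by omega) (by omega) (by omega) (by omega) (by omega)
      exact ⟨this, this⟩
  · refine .inl ⟨f (i + 1), hm _ (by omega), E.color_ne (by omega) (by omega) (by omega)
      (by omega) (by omega), E.around_avoiding (by omega) hhL.le subset_rfl
      (hn _ (by omega)) (hn _ (by omega)) hends fun s hs hs' => ⟨?_, ?_⟩⟩ <;>
    exact E.color_ne (by omega) (by omega) (by omega) (by omega) (by omega)

/-- An ear with an odd number, at least three, of inner vertices turns `IsMatched` into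
`IsFlexible`. -/
theorem isFlexible_of_odd (E : EarColoring G c c' S S' O O' x f L p) (hL : L = 2 * p)
    (hp : 2 ≤ p) (M : G.IsMatched c S O) : G.IsFlexible c' S' O' := by
  refine ⟨?_, E.nonFull_of_odd hL hp M, E.pairs (P := G.Cover c' S' O') (fun _ _ h => h.symm) ?_ ?_ ?_⟩
  · obtain ⟨o, ho⟩ := M.nonempty
    exact exists_two_of_three (E.subset ho) (E.color_mem 0 (by omega)) (E.color_mem 1 (by omega))
      (fun h => E.new 0 (by omega) (by omega) (h ▸ ho))
      (fun h => E.new 1 (by omega) (by omega) (h ▸ ho))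
      (E.color_ne (by omega) (by omega) (by omega) (by omega) (by omega))
  · intro a ha b hb hab
    by_cases h : G.NonFull c S O a (x L) ∧ G.NonFull c S O b (x 0)
    · exact E.cover_old_of_odd hL hp M hb h.1 h.2
    · refine (E.cover_old_of_odd hL hp M ha ?_ ?_).symm <;> by_contra h' <;> refine h ⟨?_, ?_⟩ <;>
        by_contra h''
      · exact hab (M.unique _ E.end_mem a ha b hb (fun h => h'' h.symm) fun h => h' h.symm)
      · exact E.ends_ne (M.unique b hb _ E.start_mem _ E.end_mem h'' h')
      · exact E.ends_ne (M.unique a ha _ E.start_mem _ E.end_mem h' h'')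
      · exact hab (M.unique _ E.start_mem a ha b hb (fun h => h' h.symm) fun h => h'' h.symm)
  · intro i hi hi' b hb
    rcases lt_trichotomy i p with h | rfl | h
    · exact E.cover_far_of_odd hL M hi h (.inl hb)
    · exact E.cover_mid_of_odd hL hp M hb
    · have := E.reverse.cover_far_of_odd hL M (i := L - i) (by omega) (by omega) (.inl hb)
      simpa only [Nat.sub_sub_self hi'.le] using this
  · have key : ∀ {x f}, EarColoring G c c' S S' O O' x f L p → ∀ i j, 0 < i → i < j → j < L →
        i < p → G.Cover c' S' O' (x i) (x j) := by
      intro x f E i j hi hij hj hip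
      rcases le_or_gt j (i + p) with h | h
      · exact E.cover_near_of_odd hL M hi hip hij hj h
      · exact E.cover_far_of_odd hL M hi hip (.inr ⟨j, h, hj, rfl⟩)
    intro i j hi hij hj
    rcases lt_or_ge i p with h | h
    · exact key E i j hi hij hj h
    · have := key E.reverse (L - j) (L - i) (by omega) (by omega) (by omega) (by omega)
      simp only [Nat.sub_sub_self hj.le, Nat.sub_sub_self (hij.trans hj).le] at this
      exact this.symm

end EarColoring

namespace EarColoring

variable {c c' : Sym2 V → ℕ} {S S' : Set V} {O O' A B : Set ℕ} {x : ℕ → V} {f : ℕ → ℕ} {L p : ℕ}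
  {u v w : V} {i j k h γ δ α : ℕ}

theorem back_nonFull (E : EarColoring G c c' S S' O O' x f L p) (hi : i + p ≤ L)
    (M : G.IsFlexible c S O) (hv : v ∈ S) : G.NonFull c' S' O' (x i) v := by
  have h2 := E.le_two_mul
  obtain ⟨γ, hγ, h⟩ := M.nonFull _ E.start_mem v hv
  refine ⟨γ, E.subset hγ, .single <| E.back_avoiding (by omega) Set.sdiff_subset (by simp) (by simp)
    h fun s hs => ?_⟩
  have := E.new s (by omega) (by omega)
  have h2 : f s ≠ γ := fun h => this (h ▸ hγ)
  exact ⟨fun h => this h.1, h2, h2⟩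

theorem around_nonFull (E : EarColoring G c c' S S' O O' x f L p) (hij : i + p ≤ j) (hj : j ≤ L)
    (M : G.IsFlexible c S O) : G.NonFull c' S' O' (x i) (x j) := by
  obtain ⟨γ, hγ, h⟩ := M.nonFull _ E.start_mem _ E.end_mem
  refine ⟨γ, E.subset hγ, .single <| E.around_avoiding hij hj Set.sdiff_subset (by simp) (by simp)
    h fun s hs hs' => ?_⟩
  have := E.new s (by omega) (by omega)
  have h2 : f s ≠ γ := fun h => this (h ▸ hγ)
  exact ⟨h2, h2⟩

theorem back_twoMissing (E : EarColoring G c c' S S' O O' x f L p) (hh : h + p ≤ L) (hα : α ∈ O)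
    (H : G.TwoMissing c S O α v (x 0)) : G.TwoMissing c' S' O' α v (x h) := by
  have h2 := E.le_two_mul
  obtain ⟨δ, hδ, hne, H⟩ := H
  refine ⟨δ, E.subset hδ, hne, .symm <| E.back_avoiding (by omega) Set.sdiff_subset (by simp)
    (by simp) H.symm fun s hs => ?_⟩
  have := E.new s (by omega) (by omega)
  exact ⟨fun h => this h.1, fun h => this (h ▸ hα), fun h => this (h ▸ hδ)⟩

theorem back_reach (E : EarColoring G c c' S S' O O' x f L p) (hh : h + p ≤ L) (hα : α ∈ O)
    (H : G.RainbowReach c S (O \ {α}) v (x 0)) : G.RainbowReach c' S' (O' \ {α}) v (x h) := by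
  have h2 := E.le_two_mul
  refine .single <| .symm <| E.back_avoiding (by omega) Set.sdiff_subset (by simp)
    (by simp) H.symm fun s hs => ?_
  have := E.new s (by omega) (by omega)
  have h2 : f s ≠ α := fun h => this (h ▸ hα)
  exact ⟨fun h => this h.1, h2, h2⟩

theorem back_twoMissing_of_reach (E : EarColoring G c c' S S' O O' x f L p) (hh : h + p < L)
    (hα : α ∈ O) (H : G.RainbowReach c S (O \ {α}) v (x 0)) : G.TwoMissing c' S' O' α v (x h) := by
  have h2 := E.le_two_mul
  have hn : ∀ s ≤ h, f s ∉ O := fun s hs => E.new s (by omega) (by omega)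
  have hne : ∀ s ≤ h, f s ≠ α := fun s hs h => hn s hs (h ▸ hα)
  refine ⟨f h, E.color_mem h (by omega), hne h le_rfl, .symm <| E.back_avoiding (by omega)
    Set.sdiff_subset (by simp) (fun h' => hn h le_rfl h'.1) H.symm fun s hs =>
    ⟨fun h' => hn s hs.le h'.1, hne s hs.le, ?_⟩⟩
  exact E.color_ne (by omega) (by omega) (by omega) (by omega) (by omega)

theorem cover_old_of_even (E : EarColoring G c c' S S' O O' x f L p) (hL : L + 1 = 2 * p)
    (hp : 2 ≤ p) {a b : V} (H : G.Cover c S O a b) : G.Cover c' S' O' a b := by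
  obtain ⟨α, hα, β, hβ, hne, v₀, H⟩ := H
  have h00 := E.new 0 (by omega) (by omega)
  have h0' := E.color_mem 0 (by omega)
  have key : ∀ {x f}, EarColoring G c c' S S' O O' x f L p → ∀ v₁, (x 0 = v₀ → v₁ = x (p - 1)) →
      ∀ h, h < p → G.TwoMissing c' S' O' α a (x h) ∨ G.TwoMissing c' S' O' β b (x h) ∨
    (x h = v₁ ∧ (G.RainbowReach c' S' (O' \ {α}) a (x h) ∨
      G.RainbowReach c' S' (O' \ {β}) b (x h))) := by
    intro x f E v₁ hv₁ h hh
    rcases H _ E.start_mem with H | H | ⟨h0, H⟩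
    · exact .inl <| E.back_twoMissing (by omega) hα H
    · exact .inr <| .inl <| E.back_twoMissing (by omega) hβ H
    by_cases hhp : h = p - 1
    · refine .inr <| .inr ⟨by rw [hv₁ h0, hhp], H.imp ?_ ?_⟩
      exacts [E.back_reach (by omega) hα, E.back_reach (by omega) hβ]
    · rcases H with H | H
      exacts [.inl <| E.back_twoMissing_of_reach (by omega) hα H,
        .inr <| .inl <| E.back_twoMissing_of_reach (by omega) hβ H]
  obtain ⟨v₁, h₁, h₂⟩ : ∃ v₁, (x 0 = v₀ → v₁ = x (p - 1)) ∧ (x L = v₀ → v₁ = x p) := by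
    by_cases h0 : x 0 = v₀
    · exact ⟨_, fun _ => rfl, fun h => absurd (h0.trans h.symm) E.ends_ne⟩
    · exact ⟨_, fun h => absurd h h0, fun _ => rfl⟩
  have old : ∀ α ∈ O, ∀ a, ∀ v, G.RainbowReach c S (O \ {α}) a v → G.TwoMissing c' S' O' α a v :=
    fun α hα a v h => ⟨f 0, h0', fun h => h00 (h ▸ hα), E.old_avoiding Set.sdiff_subset (by simp)
      (fun h => h00 h.1) h⟩
  refine ⟨α, E.subset hα, β, E.subset hβ, hne, v₁, fun v hv => ?_⟩
  rcases (E.mem_iff v).1 hv with hv | ⟨h, h0, hhL, rfl⟩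
  · have weaken : ∀ α a, G.TwoMissing c S O α a v → G.RainbowReach c S (O \ {α}) a v := by
      rintro α a ⟨δ, -, -, h⟩
      exact h.mono (Set.sdiff_subset_sdiff_right (by simp))
    rcases H v hv with H | H | ⟨-, H | H⟩
    exacts [.inl <| old _ hα _ _ (weaken _ _ H), .inr <| .inl <| old _ hβ _ _ (weaken _ _ H),
      .inl <| old _ hα _ _ H, .inr <| .inl <| old _ hβ _ _ H]
  rcases lt_or_ge h p with hhp | hhp
  · exact key E v₁ h₁ h hhp
  · have := key E.reverse v₁ (by simpa [show L - (p - 1) = p by omega] using h₂) (L - h) (by omega)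
    simpa only [Nat.sub_sub_self hhL.le] using this

theorem cover_mixed_of_even (E : EarColoring G c c' S S' O O' x f L p) (hL : L + 1 = 2 * p)
    (M : G.IsFlexible c S O) (hi : 0 < i) (hip : i < p) {b : V} (hb : b ∈ S) :
    G.Cover c' S' O' (x i) b := by
  obtain ⟨o, ho, o', ho', hoμ, hoμ', hoo'⟩ := M.exists_two (f (p - 1))
  have hn : ∀ s < L, s ≠ p - 1 → f s ∉ O := fun s hs h => E.new s hs (by omega)
  have hno : ∀ o ∈ O, o ≠ f (p - 1) → ∀ s < L, f s ≠ o := by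
    rintro _ ho hoμ s hs rfl
    by_cases h : s = p - 1
    · exact hoμ (by rw [h])
    · exact hn s hs h ho
  have hm : ∀ s < L, f s ∈ O' := E.color_mem
  refine ⟨o, E.subset ho, f (i - 1), hm _ (by omega), (hno o ho hoμ _ (by omega)).symm, b,
    fun v hv => ?_⟩
  rcases (E.mem_iff v).1 hv with hv | ⟨h, h0, hhL, rfl⟩
  · obtain ⟨γ, hγ, H⟩ := M.nonFull b hb v hv
    exact .inr <| .inl ⟨γ, E.subset hγ, fun h => hn _ (by omega) (by omega) (h ▸ hγ),
      E.old_avoiding Set.sdiff_subset (fun h => hn _ (by omega) (by omega) h.1) (by simp) H⟩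
  rcases lt_or_ge h i with hhi | hhi
  · obtain ⟨γ, hγ, H⟩ := M.nonFull _ E.start_mem b hb
    refine .inr <| .inl ⟨γ, E.subset hγ, fun h => hn _ (by omega) (by omega) (h ▸ hγ),
      .symm <| E.back_avoiding (by omega) Set.sdiff_subset
      (fun h => hn _ (by omega) (by omega) h.1) (by simp) H fun s hs =>
        ⟨fun h => hn s (by omega) (by omega) h.1, ?_,
        fun h => hn s (by omega) (by omega) (h ▸ hγ)⟩⟩
    exact E.color_ne (by omega) (by omega) (by omega) (by omega) (by omega)
  rcases lt_or_ge h (i + p) with hhp | hhp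
  · exact .inl ⟨o', E.subset ho', hoo'.symm, E.along_avoiding hhi hhL.le hhp.le fun s hs hs' =>
      ⟨hno o ho hoμ s (by omega), hno o' ho' hoμ' s (by omega)⟩⟩
  · obtain ⟨γ, hγ, H⟩ := M.nonFull _ E.end_mem b hb
    refine .inr <| .inl ⟨γ, E.subset hγ, fun h => hn _ (by omega) (by omega) (h ▸ hγ),
      .symm <| E.forth_avoiding (by omega) hhL.le Set.sdiff_subset
      (fun h => hn _ (by omega) (by omega) h.1) (by simp) H fun s hs hs' =>
        ⟨fun h => hn s (by omega) (by omega) h.1, ?_,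
        fun h => hn s (by omega) (by omega) (h ▸ hγ)⟩⟩
    exact E.color_ne (by omega) (by omega) (by omega) (by omega) (by omega)

theorem cover_far_of_even (E : EarColoring G c c' S S' O O' x f L p) (hL : L + 1 = 2 * p)
    (M : G.IsFlexible c S O) (hi : 0 < i) (hij : i + p < j) (hj : j < L) :
    G.Cover c' S' O' (x i) (x j) := by
  obtain ⟨o, ho, o', ho', hoμ, hoμ', hoo'⟩ := M.exists_two (f (p - 1))
  have hn : ∀ s < L, s ≠ p - 1 → f s ∉ O := fun s hs h => E.new s hs (by omega)
  have hno : ∀ o ∈ O, o ≠ f (p - 1) → ∀ s < L, f s ≠ o := by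
    rintro _ ho hoμ s hs rfl
    by_cases h : s = p - 1
    · exact hoμ (by rw [h])
    · exact hn s hs h ho
  have hm : ∀ s < L, f s ∈ O' := E.color_mem
  refine ⟨o, E.subset ho, f i, hm _ (by omega), (hno o ho hoμ _ (by omega)).symm, x 0,
    fun v hv => ?_⟩
  rcases (E.mem_iff v).1 hv with hv | ⟨h, h0, hhL, rfl⟩
  · obtain ⟨γ, hγ, H⟩ := M.nonFull _ E.end_mem v hv
    refine .inr <| .inl ⟨γ, E.subset hγ, fun h => hn _ (by omega) (by omega) (h ▸ hγ),
      E.forth_avoiding (by omega) hj.le Set.sdiff_subset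
      (fun h => hn _ (by omega) (by omega) h.1) (by simp) H fun s hs hs' =>
        ⟨fun h => hn s (by omega) (by omega) h.1, ?_,
        fun h => hn s (by omega) (by omega) (h ▸ hγ)⟩⟩
    exact E.color_ne (by omega) (by omega) (by omega) (by omega) (by omega)
  rcases le_or_gt h i with hhi | hhi
  · obtain ⟨γ, hγ, H⟩ := M.nonFull _ E.start_mem _ E.end_mem
    refine .inr <| .inl ⟨γ, E.subset hγ, fun h => hn _ (by omega) (by omega) (h ▸ hγ),
      .symm <| E.around_avoiding (by omega) hj.le Set.sdiff_subset
      (fun h => hn _ (by omega) (by omega) h.1) (by simp) H fun s hs hs' =>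
        ⟨?_, fun h => hn s (by omega) (by omega) (h ▸ hγ)⟩⟩
    exact E.color_ne (by omega) (by omega) (by omega) (by omega) (by omega)
  rcases le_or_gt h (i + p) with hhp | hhp
  · exact .inl ⟨o', E.subset ho', hoo'.symm, E.along_avoiding hhi.le hhL.le hhp fun s hs hs' =>
      ⟨hno o ho hoμ s (by omega), hno o' ho' hoμ' s (by omega)⟩⟩
  · refine .inr <| .inl ⟨o, E.subset ho, (hno o ho hoμ _ (by omega)).symm, ?_⟩
    rcases le_total j h with hjh | hjh
    · refine E.along_avoiding hjh hhL.le (by omega) fun s hs hs' =>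
        ⟨?_, hno o ho hoμ s (by omega)⟩
      exact E.color_ne (by omega) (by omega) (by omega) (by omega) (by omega)
    · refine .symm <| E.along_avoiding hjh hj.le (by omega) fun s hs hs' =>
        ⟨?_, hno o ho hoμ s (by omega)⟩
      exact E.color_ne (by omega) (by omega) (by omega) (by omega) (by omega)

theorem cover_near_of_even (E : EarColoring G c c' S S' O O' x f L p) (hL : L + 1 = 2 * p)
    (M : G.IsFlexible c S O) (hi : 0 < i) (hip : i + 1 < p) (hij : i < j) (hj : j < L)
    (hjp : j ≤ i + p) : G.Cover c' S' O' (x i) (x j) := by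
  obtain ⟨o, ho, o', ho', hoμ, hoμ', hoo'⟩ := M.exists_two (f (p - 1))
  have hn : ∀ s < L, s ≠ p - 1 → f s ∉ O := fun s hs h => E.new s hs (by omega)
  have hno : ∀ o ∈ O, o ≠ f (p - 1) → ∀ s < L, f s ≠ o := by
    rintro _ ho hoμ s hs rfl
    by_cases h : s = p - 1
    · exact hoμ (by rw [h])
    · exact hn s hs h ho
  have hm : ∀ s < L, f s ∈ O' := E.color_mem
  refine ⟨f i, hm _ (by omega), o, E.subset ho, hno o ho hoμ _ (by omega), x 0, fun v hv => ?_⟩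
  rcases (E.mem_iff v).1 hv with hv | ⟨h, h0, hhL, rfl⟩
  · obtain ⟨γ, hγ, H⟩ := M.nonFull _ E.start_mem v hv
    refine .inl ⟨γ, E.subset hγ, fun h => hn _ (by omega) (by omega) (h ▸ hγ),
      E.back_avoiding (by omega) Set.sdiff_subset
      (fun h => hn _ (by omega) (by omega) h.1) (by simp) H fun s hs =>
        ⟨fun h => hn s (by omega) (by omega) h.1, ?_,
        fun h => hn s (by omega) (by omega) (h ▸ hγ)⟩⟩
    exact E.color_ne (by omega) (by omega) (by omega) (by omega) (by omega)
  rcases le_or_gt h i with hhi | hhi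
  · refine .inl ⟨o, E.subset ho, (hno o ho hoμ _ (by omega)).symm, .symm <|
      E.along_avoiding hhi (by omega) (by omega) fun s hs hs' => ⟨?_, hno o ho hoμ s (by omega)⟩⟩
    exact E.color_ne (by omega) (by omega) (by omega) (by omega) (by omega)
  rcases le_or_gt h (i + p) with hhp | hhp
  · refine .inr <| .inl ⟨o', E.subset ho', hoo'.symm, ?_⟩
    rcases le_total h j with hhj | hhj
    · exact .symm <| E.along_avoiding hhj hj.le (by omega) fun s hs hs' =>
        ⟨hno o ho hoμ s (by omega), hno o' ho' hoμ' s (by omega)⟩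
    · exact E.along_avoiding hhj hhL.le (by omega) fun s hs hs' =>
        ⟨hno o ho hoμ s (by omega), hno o' ho' hoμ' s (by omega)⟩
  · obtain ⟨γ, hγ, H⟩ := M.nonFull _ E.start_mem _ E.end_mem
    refine .inl ⟨γ, E.subset hγ, fun h => hn _ (by omega) (by omega) (h ▸ hγ),
      E.around_avoiding (by omega) hhL.le Set.sdiff_subset
      (fun h => hn _ (by omega) (by omega) h.1) (by simp) H fun s hs hs' =>
        ⟨?_, fun h => hn s (by omega) (by omega) (h ▸ hγ)⟩⟩
    exact E.color_ne (by omega) (by omega) (by omega) (by omega) (by omega)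

/-- The next ear joins the two middle vertices of the ear. -/
theorem cover_mid_of_even (E : EarColoring G c c' S S' O O' x f L p) (hL : L + 1 = 2 * p)
    (hp : 2 ≤ p) (M : G.IsFlexible c S O) : G.Cover c' S' O' (x (p - 1)) (x p) := by
  obtain ⟨α, hα, β, hβ, hne, v₀, H⟩ := M.cover _ E.start_mem _ E.end_mem E.ends_ne
  have hn : ∀ s < L, s ≠ p - 1 → f s ∉ O := fun s hs h => E.new s hs (by omega)
  have key : ∀ {x f}, EarColoring G c c' S S' O O' x f L p → ∀ α ∈ O,
      (∀ v, G.TwoMissing c S O α (x 0) v → G.TwoMissing c' S' O' α (x (p - 1)) v) ∧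
      (∀ v, G.RainbowReach c S (O \ {α}) (x 0) v →
        G.RainbowReach c' S' (O' \ {α}) (x (p - 1)) v) ∧
      ∀ h < p, G.TwoMissing c' S' O' α (x (p - 1)) (x h) := by
    intro x f E α hα
    have hn : ∀ s < L, s ≠ p - 1 → f s ∉ O := fun s hs h => E.new s hs (by omega)
    have hno : ∀ o ∈ O, ∀ s < p - 1, f s ≠ o := fun o ho s hs h =>
      hn s (by omega) (by omega) (h ▸ ho)
    refine ⟨?_, fun v h => ?_, fun h hh => ?_⟩
    · rintro v ⟨δ, hδ, hne, h⟩
      exact ⟨δ, E.subset hδ, hne, E.back_avoiding (by omega) Set.sdiff_subset (by simp) (by simp) h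
        fun s hs => ⟨fun h => hn s (by omega) (by omega) h.1, hno α hα s hs, hno δ hδ s hs⟩⟩
    · exact .single <| E.back_avoiding (by omega) Set.sdiff_subset (by simp) (by simp) h
        fun s hs => ⟨fun h => hn s (by omega) (by omega) h.1, hno α hα s hs, hno α hα s hs⟩
    · obtain ⟨o, ho, -, -, hoα, -⟩ := M.exists_two α
      exact ⟨o, E.subset ho, hoα, .symm <| E.along_avoiding (by omega) (by omega) (by omega)
        fun s hs hs' => ⟨hno α hα s hs', hno o ho s hs'⟩⟩
  have k₁ := key E α hα
  have k₂ := key E.reverse β hβ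
  simp only [show L - (p - 1) = p by omega, Nat.sub_zero] at k₂
  refine ⟨α, E.subset hα, β, E.subset hβ, hne, v₀, fun v hv => ?_⟩
  rcases (E.mem_iff v).1 hv with hv | ⟨h, h0, hhL, rfl⟩
  · rcases H v hv with H | H | ⟨h, H⟩
    exacts [.inl (k₁.1 v H), .inr (.inl (k₂.1 v H)), .inr (.inr ⟨h, H.imp (k₁.2.1 v) (k₂.2.1 v)⟩)]
  · rcases lt_or_ge h p with hhp | hhp
    · exact .inl (k₁.2.2 h hhp)
    · have := k₂.2.2 (L - h) (by omega)
      rw [Nat.sub_sub_self hhL.le] at this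
      exact .inr (.inl this)

/-- An ear with an even number of inner vertices preserves `IsFlexible`. -/
theorem isFlexible_of_even (E : EarColoring G c c' S S' O O' x f L p) (hL : L + 1 = 2 * p)
    (hp : 2 ≤ p) (M : G.IsFlexible c S O) : G.IsFlexible c' S' O' := by
  have h00 := E.new 0 (by omega) (by omega)
  have h0' := E.color_mem 0 (by omega)
  refine ⟨fun μ => ?_, fun u hu v hv => ?_, E.pairs (P := G.Cover c' S' O') (fun _ _ h => h.symm)
    (fun a ha b hb hab => E.cover_old_of_even hL hp (M.cover a ha b hb hab)) ?_ ?_⟩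
  · obtain ⟨o, ho, o', ho', h⟩ := M.exists_two μ
    exact ⟨o, E.subset ho, o', E.subset ho', h⟩
  · by_cases huv : u = v
    · exact ⟨f 0, h0', huv ▸ .refl hu⟩
    refine E.pairs (P := G.NonFull c' S' O') (fun _ _ h => h.symm) (fun u hu v hv _ =>
      ⟨f 0, h0', .single <| E.old_avoiding subset_rfl h00 h00 (M.nonFull u hu v hv).reach⟩)
      ?_ ?_ u hu v hv huv
    · intro i hi hi' v hv
      rcases lt_or_ge i p with h | h
      · exact E.back_nonFull (by omega) M hv
      · have := E.reverse.back_nonFull (i := L - i) (by omega) M hv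
        simpa only [Nat.sub_sub_self hi'.le] using this
    · intro i j hi hij hj
      rcases lt_or_ge j (i + p) with h | h
      · exact E.nonFull_of_lt hij.le hj h
      · exact E.around_nonFull h hj.le M
  · intro i hi hi' b hb
    rcases lt_or_ge i p with h | h
    · exact E.cover_mixed_of_even hL M hi h hb
    · have := E.reverse.cover_mixed_of_even hL M (i := L - i) (by omega) (by omega) hb
      simpa only [Nat.sub_sub_self hi'.le] using this
  · intro i j hi hij hj
    rcases lt_or_ge (i + p) j with h | h
    · exact E.cover_far_of_even hL M hi h hj
    by_cases h' : i + 1 < p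
    · exact E.cover_near_of_even hL M hi h' hij hj h
    by_cases h'' : j ≤ p
    · obtain rfl : i = p - 1 := by omega
      obtain rfl : j = p := by omega
      exact E.cover_mid_of_even hL hp M
    · have := E.reverse.cover_near_of_even hL M (i := L - j) (j := L - i) (by omega) (by omega)
        (by omega) (by omega) (by omega)
      simp only [Nat.sub_sub_self hj.le, Nat.sub_sub_self (hij.trans hj).le] at this
      exact this.symm

/-- An ear with an odd number of inner vertices turns `IsFlexible` into `IsMatched` if its two
middle edges have the colours provided by `Cover`. -/
theorem isMatched_of_odd (E : EarColoring G c c' S S' O O' x f L p) (hL : L + 2 = 2 * p)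
    (M : G.IsFlexible c S O) {v₀ : V} (hα : f (p - 2) ∈ O) (hβ : f (p - 1) ∈ O)
    (H : ∀ v ∈ S, G.TwoMissing c S O (f (p - 2)) (x 0) v ∨
      G.TwoMissing c S O (f (p - 1)) (x L) v ∨
      (v = v₀ ∧ (G.RainbowReach c S (O \ {f (p - 2)}) (x 0) v ∨
        G.RainbowReach c S (O \ {f (p - 1)}) (x L) v))) : G.IsMatched c' S' O' := by
  have hpL := E.period_le
  have key : ∀ {x f}, EarColoring G c c' S S' O O' x f L p → f (p - 2) ∈ O → ∀ v,
      (G.TwoMissing c S O (f (p - 2)) (x 0) v → G.NonFull c' S' O' (x (p - 1)) v) ∧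
      (G.RainbowReach c S (O \ {f (p - 2)}) (x 0) v → G.RainbowReach c' S' O' (x (p - 1)) v) := by
    intro x f E hα v
    have hn : ∀ s < p - 1, f s ∉ O ∨ f s = f (p - 2) := by
      intro s hs
      by_cases h : s = p - 2
      · exact .inr (by rw [h])
      · exact .inl (E.new s (by omega) (by omega))
    constructor
    · rintro ⟨δ, hδ, hne, h⟩
      refine ⟨δ, E.subset hδ, .single <| E.back_avoiding (by omega) Set.sdiff_subset (by simp)
        (by simp) h fun s hs => ?_⟩
      have : f s ≠ δ := by
        rcases hn s hs with h | h
        exacts [fun h' => h (h' ▸ hδ), fun h' => hne (h' ▸ h)]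
      refine ⟨fun h' => ?_, this, this⟩
      exact (hn s hs).elim (fun h => h h'.1) (fun h => h'.2 (.inl h))
    · intro h
      refine (E.back (by omega) h fun s hs h' => ?_).mono (E.subset_all Set.sdiff_subset ?_)
      · exact (hn s hs).elim (fun h => h h'.1) (fun h => h'.2 h)
      · intro s hs
        have : s < p - 1 := hs
        omega
  have hLp : L - (p - 1) = p - 1 := by omega
  have e1 : f (L - 1 - (p - 2)) = f (p - 1) := by congr 1; omega
  have k₁ := key E hα
  have k₂ := key E.reverse (by rwa [e1])
  simp only [hLp, e1, Nat.sub_zero] at k₂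
  have hmid : ∀ v ∈ S, G.RainbowReach c' S' O' (x (p - 1)) v ∧
      (v = v₀ ∨ G.NonFull c' S' O' (x (p - 1)) v) := by
    intro v hv
    rcases H v hv with H | H | ⟨h, H | H⟩
    exacts [⟨((k₁ v).1 H).reach, .inr ((k₁ v).1 H)⟩, ⟨((k₂ v).1 H).reach, .inr ((k₂ v).1 H)⟩,
      ⟨(k₁ v).2 H, .inl h⟩, ⟨(k₂ v).2 H, .inl h⟩]
  have all : ∀ u ∈ S', ∀ v ∈ S', u ≠ v → G.RainbowReach c' S' O' u v ∧
      (G.NonFull c' S' O' u v ∨ u = x (p - 1) ∧ v = v₀ ∨ u = v₀ ∧ v = x (p - 1)) := by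
    refine E.pairs ?_ ?_ ?_ ?_
    · rintro u v ⟨h1, h2⟩
      refine ⟨h1.symm, ?_⟩
      rcases h2 with h2 | h2 | h2
      exacts [.inl h2.symm, .inr (.inr h2.symm), .inr (.inl h2.symm)]
    · intro u hu v hv _
      obtain ⟨γ, hγ, h⟩ := M.nonFull u hu v hv
      have : G.NonFull c' S' O' u v :=
        ⟨γ, E.subset hγ, .single <| E.old_avoiding Set.sdiff_subset (by simp) (by simp) h⟩
      exact ⟨this.reach, .inl this⟩
    · intro i hi hi' v hv
      have aux : G.NonFull c' S' O' (x i) v → G.RainbowReach c' S' O' (x i) v ∧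
        (G.NonFull c' S' O' (x i) v ∨ x i = x (p - 1) ∧ v = v₀ ∨ x i = v₀ ∧ v = x (p - 1)) :=
        fun h => ⟨h.reach, .inl h⟩
      rcases lt_trichotomy i (p - 1) with h | rfl | h
      · exact aux (E.back_nonFull (by omega) M hv)
      · have := hmid v hv
        tauto
      · refine aux ?_
        have := E.reverse.back_nonFull (i := L - i) (by omega) M hv
        simpa only [Nat.sub_sub_self hi'.le] using this
    · intro i j hi hij hj
      have : G.NonFull c' S' O' (x i) (x j) := by
        rcases lt_or_ge j (i + p) with h | h
        · exact E.nonFull_of_lt hij.le hj h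
        · exact E.around_nonFull h hj.le M
      exact ⟨this.reach, .inl this⟩
  have hne : O'.Nonempty := ⟨_, E.subset hα⟩
  refine ⟨hne, fun u hu v hv => ?_, fun u hu v hv w hw h1 h2 => ?_⟩
  · by_cases huv : u = v
    · exact huv ▸ .refl hu
    · exact (all u hu v hv huv).1
  · have hrefl : G.NonFull c' S' O' u u := by
      obtain ⟨o, ho⟩ := hne
      exact ⟨o, ho, .refl hu⟩
    have huv : u ≠ v := by rintro rfl; exact h1 hrefl
    have huw : u ≠ w := by rintro rfl; exact h2 hrefl
    rcases (all u hu v hv huv).2.resolve_left h1 with ⟨h3, h4⟩ | ⟨h3, h4⟩ <;>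
      rcases (all u hu w hw huw).2.resolve_left h2 with ⟨h5, h6⟩ | ⟨h5, h6⟩
    · rw [h4, h6]
    · exact absurd (h5.trans h4.symm) huv
    · exact absurd (h5.trans h4.symm) huv
    · rw [h4, h6]

end EarColoring

/-- `x 0, …, x L` is an ear of `S`: a path of `G` with distinct ends in `S`, at least one inner
vertex, and all its inner vertices outside `S`. -/
structure IsEar (G : SimpleGraph V) (S : Set V) (x : ℕ → V) (L : ℕ) : Prop where
  start_mem : x 0 ∈ S
  end_mem : x L ∈ S
  inner : ∀ i, 0 < i → i < L → x i ∉ S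
  adj : ∀ i < L, G.Adj (x i) (x (i + 1))
  inj : ∀ i ≤ L, ∀ j ≤ L, x i = x j → i = j
  two_le : 2 ≤ L

namespace IsEar

variable {S : Set V} {x : ℕ → V} {L : ℕ}

theorem edge_inj (H : G.IsEar S x L) {i j : ℕ} (hi : i < L) (hj : j < L)
    (h : s(x i, x (i + 1)) = s(x j, x (j + 1))) : i = j := by
  rw [Sym2.eq_iff] at h
  rcases h with ⟨h, -⟩ | ⟨h, h'⟩
  · exact H.inj i hi.le j hj.le h
  · have := H.inj i hi.le (j + 1) hj h
    have := H.inj (i + 1) hi j hj.le h'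
    omega

theorem edge_ne (H : G.IsEar S x L) {i : ℕ} (hi : i < L) {u v : V} (hu : u ∈ S) (hv : v ∈ S) :
    s(x i, x (i + 1)) ≠ s(u, v) := by
  have h2 := H.two_le
  have : x i ∉ S ∨ x (i + 1) ∉ S := by
    rcases Nat.eq_zero_or_pos i with rfl | h0
    · exact .inr (H.inner 1 (by omega) (by omega))
    · exact .inl (H.inner i h0 hi)
  rw [Ne, Sym2.eq_iff]
  rintro (⟨h, h'⟩ | ⟨h, h'⟩) <;> rw [h, h'] at this <;> tauto

theorem ncard_union [Finite V] (H : G.IsEar S x L) :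
    (S ∪ x '' Set.Ioo 0 L).ncard = S.ncard + (L - 1) := by
  rw [Set.ncard_union_eq, Set.InjOn.ncard_image, ← Finset.coe_Ioo, Set.ncard_coe_finset,
    Nat.card_Ioo, Nat.sub_zero]
  · exact fun i hi j hj h => H.inj i hi.2.le j hj.2.le h
  · rw [Set.disjoint_right]
    rintro _ ⟨i, hi, rfl⟩
    exact H.inner i hi.1 hi.2

/-- An ear can be coloured periodically by new colours, and by prescribed old colours `g i` on the
edges without a partner. -/
theorem exists_earColoring (H : G.IsEar S x L) (c : Sym2 V → ℕ) (O : Finset ℕ) {p : ℕ}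
    (hp : 0 < p) (hpL : p ≤ L) (hLp : L ≤ 2 * p) (g : ℕ → ℕ)
    (hg : ∀ i, L ≤ i + p → i < p → g i ∈ O)
    (hg' : ∀ i j, L ≤ i + p → i < p → L ≤ j + p → j < p → g i = g j → i = j) :
    ∃ (c' : Sym2 V → ℕ) (O' : Finset ℕ) (f : ℕ → ℕ),
      G.EarColoring c c' S (S ∪ x '' Set.Ioo 0 L) O O' x f L p ∧ O'.card = O.card + (L - p) ∧
      ∀ i, L ≤ i + p → i < p → f i = g i := by
  classical
  set M := O.sup id + 1 with hM
  have hOM : ∀ o ∈ O, o < M := fun o ho => Nat.lt_succ_of_le (Finset.le_sup (f := id) ho)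
  set f : ℕ → ℕ := fun i => if i + p < L then M + i else if p ≤ i then M + (i - p) else g i with hf
  set c' : Sym2 V → ℕ := fun e =>
    if h : ∃ i, i < L ∧ e = s(x i, x (i + 1)) then f h.choose else c e with hc'
  have hcol : ∀ i < L, c' s(x i, x (i + 1)) = f i := by
    intro i hi
    have h : ∃ j, j < L ∧ s(x i, x (i + 1)) = s(x j, x (j + 1)) := ⟨i, hi, rfl⟩
    rw [hc']
    simp only [dif_pos h]
    exact congrArg f (H.edge_inj hi h.choose_spec.1 h.choose_spec.2).symm
  have hold : ∀ u ∈ S, ∀ v ∈ S, c' s(u, v) = c s(u, v) := by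
    intro u hu v hv
    rw [hc']
    exact dif_neg fun ⟨i, hi, h⟩ => H.edge_ne hi hu hv h.symm
  have f1 : ∀ i, i + p < L → f i = M + i := fun i hi => by simp [hf, hi]
  have f2 : ∀ i < L, p ≤ i → f i = M + (i - p) := fun i hi hi' => by
    have : ¬ i + p < L := by omega
    simp [hf, this, hi']
  have f3 : ∀ i, L ≤ i + p → i < p → f i = g i := fun i hi hi' => by
    simp [hf, hi.not_gt, hi'.not_ge]
  have f3' : ∀ i, L ≤ i + p → i < p → f i < M := fun i hi hi' => by
    rw [f3 i hi hi']
    exact hOM _ (hg i hi hi')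
  refine ⟨c', O ∪ (Finset.range (L - p)).image (M + ·), f, ?_, ?_, f3⟩
  · refine ⟨H.start_mem, H.end_mem, fun h => ?_, fun v => ?_, fun A u v h => h.of_agree
      Set.subset_union_left hold, H.adj, hcol, fun i hi j hj => ?_, fun i hi h ho => ?_, ?_,
      fun i hi => ?_, hpL, hLp⟩
    · have := H.inj 0 (by omega) L le_rfl h
      omega
    · simp [and_assoc]
    · rcases lt_or_ge (i + p) L with h1 | h1 <;> rcases lt_or_ge (j + p) L with h2 | h2
      · rw [f1 i h1, f1 j h2]; omega
      · rw [f1 i h1]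
        rcases le_or_gt p j with h3 | h3
        · rw [f2 j hj h3]; omega
        · have := f3' j h2 h3; omega
      · rw [f1 j h2]
        rcases le_or_gt p i with h3 | h3
        · rw [f2 i hi h3]; omega
        · have := f3' i h1 h3; omega
      · rcases le_or_gt p i with h3 | h3 <;> rcases le_or_gt p j with h4 | h4
        · rw [f2 i hi h3, f2 j hj h4]; omega
        · rw [f2 i hi h3]
          have := f3' j h2 h4; omega
        · rw [f2 j hj h4]
          have := f3' i h1 h3; omega
        · rw [f3 i h1 h3, f3 j h2 h4]
          refine ⟨fun h => .inl (hg' i j h1 h3 h2 h4 h), fun h => ?_⟩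
          rw [show i = j by omega]
    · have := hOM _ (Finset.mem_coe.1 ho)
      rcases lt_or_ge (i + p) L with h1 | h1
      · rw [f1 i h1] at this; omega
      · rw [f2 i hi (by omega)] at this; omega
    · simp
    · simp only [Finset.coe_union, Finset.coe_image, Finset.coe_range, Set.mem_union,
        Finset.mem_coe, Set.mem_image, Set.mem_Iio]
      rcases lt_or_ge (i + p) L with h1 | h1
      · exact .inr ⟨i, by omega, (f1 i h1).symm⟩
      · rcases le_or_gt p i with h3 | h3
        · exact .inr ⟨i - p, by omega, (f2 i hi h3).symm⟩
        · left
          rw [f3 i h1 h3]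
          exact hg i h1 h3
  · rw [Finset.card_union_of_disjoint, Finset.card_image_of_injective _ (add_right_injective M),
      Finset.card_range]
    rw [Finset.disjoint_right]
    intro o ho ho'
    obtain ⟨i, -, rfl⟩ := Finset.mem_image.1 ho
    have := hOM _ ho'
    omega

end IsEar

theorem Walk.IsPath.isEar {S : Set V} {a b : V} {q : G.Walk a b} (hq : q.IsPath) (ha : a ∈ S)
    (hb : b ∈ S) (hS : ∀ v ∈ q.support, v ∈ S → v = a ∨ v = b) (h2 : 2 ≤ q.length) :
    G.IsEar S q.getVert q.length where
  start_mem := by simpa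
  end_mem := by simpa
  inner i h0 hi h := by
    rcases hS _ (q.getVert_mem_support i) h with h' | h'
    · have := hq.getVert_injOn (x₁ := i) (x₂ := 0) hi.le (Nat.zero_le _) (by simpa using h')
      omega
    · have := hq.getVert_injOn (x₁ := i) (x₂ := q.length) hi.le (show q.length ≤ q.length from le_rfl) (by simpa using h')
      omega
  adj i hi := q.adj_getVert_succ hi
  inj i hi j hj h := hq.getVert_injOn hi hj h
  two_le := h2

namespace IsTwoConnected

variable {S : Set V}

theorem exists_path_avoiding [Finite V] (hG : G.IsTwoConnected) {u w s : V} (hwu : w ≠ u)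
    (hs : s ∈ S) (hsu : s ≠ u) : ∃ h ∈ S, h ≠ u ∧ ∃ p : G.Walk w h, p.IsPath ∧ u ∉ p.support ∧
      ∀ v ∈ p.support, v ∈ S → v = h := by
  classical
  have := Fintype.ofFinite V
  have hw' : w ∈ ({u}ᶜ : Set V) := hwu
  have hs' : s ∈ ({u}ᶜ : Set V) := hsu
  obtain ⟨q⟩ := (hG.connected_delete u).preconnected ⟨w, hw'⟩ ⟨s, hs'⟩
  obtain ⟨q', hu⟩ : ∃ q' : G.Walk w s, u ∉ q'.support := by
    refine ⟨q.map (Embedding.induce _).toHom, fun h => ?_⟩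
    obtain ⟨y, -, hy⟩ := List.mem_map.1 (Walk.support_map _ q ▸ h)
    exact y.2 hy
  obtain ⟨h, hh, hx, hfirst⟩ := q'.exists_mem_support_forall_mem_support_imp_eq S.toFinset
    ⟨s, by simp [hs]⟩
  have hsub := q'.support_takeUntil_subset_support hx
  refine ⟨h, by simpa using hh, fun h' => hu (h' ▸ hx), (q'.takeUntil h hx).bypass,
    Walk.bypass_isPath _, fun h' => hu (hsub (Walk.support_bypass_subset_support _ h')), fun v hv hvS =>
    hfirst v (by simpa using hvS) (Walk.support_bypass_subset_support _ hv)⟩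

theorem exists_adj_boundary (hG : G.IsTwoConnected) {u v : V} (hu : u ∈ S) (hv : v ∉ S) :
    ∃ h ∈ S, ∃ w ∉ S, G.Adj h w := by
  obtain ⟨p⟩ := hG.connected.preconnected u v
  obtain ⟨d, -, h1, h2⟩ := p.exists_boundary_dart S hu hv
  exact ⟨_, h1, _, h2, d.adj⟩

theorem exists_isEar [Finite V] (hG : G.IsTwoConnected) {a b v : V} (ha : a ∈ S) (hb : b ∈ S)
    (hab : a ≠ b) (hv : v ∉ S) : ∃ x L, G.IsEar S x L := by
  obtain ⟨h, hh, w, hw, hadj⟩ := hG.exists_adj_boundary ha hv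
  obtain ⟨s, hs, hsh⟩ : ∃ s ∈ S, s ≠ h := by
    by_cases e : a = h
    · exact ⟨b, hb, fun e' => hab (e.trans e'.symm)⟩
    · exact ⟨a, ha, e⟩
  obtain ⟨h', hh', hne, p, hp, hhp, hS⟩ := hG.exists_path_avoiding (w := w) hadj.ne' hs hsh
  refine ⟨_, _, Walk.IsPath.isEar (q := .cons hadj p) (hp.cons hhp) hh hh' ?_ ?_⟩
  · intro v hv hvS
    rw [Walk.support_cons, List.mem_cons] at hv
    exact hv.imp_right fun h => hS v h hvS
  · have : p.length ≠ 0 := fun h => hw (Walk.eq_of_length_eq_zero h ▸ hh')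
    rw [Walk.length_cons]
    omega

/-- If two adjacent vertices lie outside `S`, and one of them has a neighbour in `S`, then there is
an ear with at least two inner vertices. -/
theorem exists_isEar_of_adj [Finite V] (hG : G.IsTwoConnected) {a b h u w : V} (ha : a ∈ S)
    (hb : b ∈ S) (hab : a ≠ b) (hh : h ∈ S) (hu : u ∉ S) (hw : w ∉ S) (hhu : G.Adj h u)
    (huw : G.Adj u w) : ∃ x L, G.IsEar S x L ∧ 3 ≤ L := by
  have long : ∀ {k k' : V}, k ∈ S → k' ∈ S → k ≠ k' → G.Adj k u → ∀ {w : V}, w ∉ S → G.Adj u w →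
      ∀ p : G.Walk w k', p.IsPath → u ∉ p.support → (∀ v ∈ p.support, v ∈ S → v = k') →
      ∃ x L, G.IsEar S x L ∧ 3 ≤ L := by
    intro k k' hk hk' hkk' hku w hw huw p hp hup hS
    have hkp : k ∉ p.support := fun h => hkk' (hS k h hk)
    have hk0 : p.length ≠ 0 := fun h => hw (Walk.eq_of_length_eq_zero h ▸ hk')
    refine ⟨_, _, Walk.IsPath.isEar (q := .cons hku (.cons huw p))
      ((hp.cons hup).cons ?_) hk hk' ?_ ?_, ?_⟩
    · rw [Walk.support_cons, List.mem_cons]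
      exact not_or.2 ⟨hku.ne, hkp⟩
    · intro v hv hvS
      simp only [Walk.support_cons, List.mem_cons] at hv
      rcases hv with rfl | rfl | hv
      exacts [.inl rfl, absurd hvS hu, .inr (hS v hv hvS)]
    · simp only [Walk.length_cons]
      omega
    · simp only [Walk.length_cons]
      omega
  obtain ⟨k, hk, -, p, hp, hup, hS⟩ := hG.exists_path_avoiding (w := w) huw.ne' ha
    (fun h => hu (h ▸ ha))
  by_cases hkh : h = k
  · subst hkh
    obtain ⟨s, hs, hsh⟩ : ∃ s ∈ S, s ≠ h := by
      by_cases e : a = h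
      · exact ⟨b, hb, fun e' => hab (e.trans e'.symm)⟩
      · exact ⟨a, ha, e⟩
    obtain ⟨k', hk', hne, q, hq, hhq, hS'⟩ := hG.exists_path_avoiding (w := u) hhu.ne' hs hsh
    cases q with
    | nil => exact absurd hk' hu
    | @cons _ y _ huy q =>
      rw [Walk.cons_isPath_iff] at hq
      simp only [Walk.support_cons, List.mem_cons, not_or] at hhq
      have hSq : ∀ v ∈ q.support, v ∈ S → v = k' := fun v hv => hS' v (by simp [hv])
      by_cases hy : y ∈ S
      · obtain rfl := hSq y q.start_mem_support hy
        exact long hy hh hne huy.symm hw huw p hp hup hS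
      · exact long hh hk' hne.symm hhu hy huy q hq.1 hq.2 hSq
  · exact long hh hk hkh hhu hw huw p hp hup hS

/-- If no ear has more than one inner vertex, the vertices outside `S` are pairwise non-adjacent,
and each has two neighbours in `S`. -/
theorem exists_two_neighbors [Finite V] (hG : G.IsTwoConnected) {a b : V} (ha : a ∈ S)
    (hb : b ∈ S) (hab : a ≠ b) (hear : ∀ x L, G.IsEar S x L → L ≤ 2) {w : V} (hw : w ∉ S) :
    ∃ k ∈ S, ∃ k' ∈ S, k ≠ k' ∧ G.Adj w k ∧ G.Adj w k' := by
  have claim : ∀ h ∈ S, ∀ u ∉ S, G.Adj h u → ∀ w, G.Adj u w → w ∈ S := by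
    intro h hh u hu hhu w huw
    by_contra hw
    obtain ⟨x, L, hE, hL⟩ := hG.exists_isEar_of_adj ha hb hab hh hu hw hhu huw
    have := hear x L hE
    omega
  have nbr : ∃ h ∈ S, G.Adj h w := by
    by_contra! hno
    obtain ⟨h, hh, w', hw', hadj⟩ := hG.exists_adj_boundary
      (S := {v | v ∈ S ∨ ∃ h ∈ S, G.Adj h v}) (u := a) (v := w) (.inl ha) (by
        rintro (h | ⟨h, hh, h'⟩)
        exacts [hw h, hno h hh h'])
    refine hw' ?_
    by_cases hhS : h ∈ S
    · exact .inr ⟨h, hhS, hadj⟩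
    · obtain ⟨k, hk, hkh⟩ := hh.resolve_left hhS
      exact .inl (claim k hk h hhS hkh w' hadj)
  obtain ⟨h, hh, hhw⟩ := nbr
  obtain ⟨s, hs, hsh⟩ : ∃ s ∈ S, s ≠ h := by
    by_cases e : a = h
    · exact ⟨b, hb, fun e' => hab (e.trans e'.symm)⟩
    · exact ⟨a, ha, e⟩
  obtain ⟨k', hk', hne, q, hq, hhq, hS'⟩ := hG.exists_path_avoiding (w := w) hhw.ne' hs hsh
  cases q with
  | nil => exact absurd hk' hw
  | @cons _ y _ hwy q =>
    have hy := claim h hh w hw hhw y hwy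
    refine ⟨h, hh, y, hy, ?_, hhw.symm, hwy⟩
    rw [hS' y (by simp) hy]
    exact hne.symm

end IsTwoConnected

/-- If every vertex outside `S` has two neighbours in `S`, these vertices can be attached to a
matched set `S` in pairs, with one new colour for each pair. -/
theorem IsMatched.exists_reach [Finite V] {c : Sym2 V → ℕ} {S : Set V} {O : Finset ℕ}
    (M : G.IsMatched c S O)
    (hS : ∀ w ∉ S, ∃ k ∈ S, ∃ k' ∈ S, k ≠ k' ∧ G.Adj w k ∧ G.Adj w k') :
    ∃ (c' : Sym2 V → ℕ) (O' : Finset ℕ), (∀ u v, G.RainbowReach c' Set.univ O' u v) ∧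
      O'.card = O.card + (Sᶜ.ncard + 1) / 2 := by
  classical
  obtain ⟨idx, hlt, hinj⟩ : ∃ idx : V → ℕ, (∀ w ∉ S, idx w < Sᶜ.ncard) ∧
      ∀ w ∉ S, ∀ w' ∉ S, idx w = idx w' → w = w' := by
    let e := Finite.equivFin (Sᶜ : Set V)
    refine ⟨fun w => if h : w ∈ Sᶜ then e ⟨w, h⟩ else 0, fun w hw => ?_, fun w hw w' hw' h => ?_⟩
    · have hw : w ∈ Sᶜ := hw
      simp only [dif_pos hw]
      exact (e ⟨w, hw⟩).2
    · have hw : w ∈ Sᶜ := hw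
      have hw' : w' ∈ Sᶜ := hw'
      simp only [dif_pos hw, dif_pos hw'] at h
      exact congrArg Subtype.val (e.injective (Fin.ext h))
  set m := O.sup id + 1 with hm
  have hOm : ∀ o ∈ O, o < m := fun o ho => Nat.lt_succ_of_le (Finset.le_sup (f := id) ho)
  have hex : ∀ w, w ∉ S → ∃ a ∈ S, ∃ b ∈ S, a ≠ b ∧ G.Adj w a ∧ G.Adj w b ∧ ∃ α ∈ O,
      ∀ x ∉ S, idx x + 1 = idx w → ∃ v ∈ S, G.Adj x v ∧
        G.RainbowReach c S ((O : Set ℕ) \ {α}) v b := by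
    intro w hw
    obtain ⟨k, hk, k', hk', hne, hwk, hwk'⟩ := hS w hw
    by_cases hx : ∃ x ∉ S, idx x + 1 = idx w
    · obtain ⟨x, hx, hxw⟩ := hx
      have huniq : ∀ y ∉ S, idx y + 1 = idx w → y = x := fun y hy hyw =>
        hinj y hy x hx (by omega)
      obtain ⟨v, hv, -, -, -, hxv, -⟩ := hS x hx
      by_cases hN : G.NonFull c S O v k
      · obtain ⟨α, hα, hN⟩ := hN
        refine ⟨k', hk', k, hk, hne.symm, hwk', hwk, α, hα, fun y hy hyw => ⟨v, hv, ?_, hN⟩⟩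
        rwa [huniq y hy hyw]
      · by_cases hN' : G.NonFull c S O v k'
        · obtain ⟨α, hα, hN'⟩ := hN'
          refine ⟨k, hk, k', hk', hne, hwk, hwk', α, hα, fun y hy hyw => ⟨v, hv, ?_, hN'⟩⟩
          rwa [huniq y hy hyw]
        · exact absurd (M.unique v hv k hk k' hk' hN hN') hne
    · obtain ⟨α, hα⟩ := M.nonempty
      exact ⟨k, hk, k', hk', hne, hwk, hwk', α, hα, fun x hxS hxw => absurd ⟨x, hxS, hxw⟩ hx⟩
  choose! a ha b hb hab hwa hwb α hα hpair using hex
  set z : V → ℕ := fun w => m + idx w / 2 with hz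
  set F : V → V → ℕ := fun w v => if idx w % 2 = 1 ∧ v = b w then α w else z w with hF
  set c' : Sym2 V → ℕ := fun e =>
    if h : ∃ q : V × V, q.1 ∉ S ∧ q.2 ∈ S ∧ e = s(q.1, q.2) then F h.choose.1 h.choose.2
    else c e with hc'
  have hcol : ∀ w ∉ S, ∀ v ∈ S, c' s(w, v) = F w v := by
    intro w hw v hv
    have h : ∃ q : V × V, q.1 ∉ S ∧ q.2 ∈ S ∧ s(w, v) = s(q.1, q.2) := ⟨(w, v), hw, hv, rfl⟩
    rw [hc']
    simp only [dif_pos h]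
    obtain ⟨h1, h2, h3⟩ := h.choose_spec
    rcases Sym2.eq_iff.1 h3 with ⟨h4, h5⟩ | ⟨h4, h5⟩
    · exact congrArg₂ F h4.symm h5.symm
    · exact absurd (h4 ▸ h2) hw
  have hold : ∀ u ∈ S, ∀ v ∈ S, c' s(u, v) = c s(u, v) := by
    intro u hu v hv
    rw [hc']
    refine dif_neg ?_
    rintro ⟨q, h1, h2, h3⟩
    rcases Sym2.eq_iff.1 h3 with ⟨h4, h5⟩ | ⟨h4, h5⟩
    · exact h1 (h4 ▸ hu)
    · exact h1 (h5 ▸ hv)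
  set O' : Finset ℕ := O ∪ (Finset.range ((Sᶜ.ncard + 1) / 2)).image (m + ·) with hO'
  have hOO' : (O : Set ℕ) ⊆ O' := by simp [hO']
  have hzO' : ∀ w ∉ S, z w ∈ O' := by
    intro w hw
    have := hlt w hw
    exact Finset.mem_union_right _ (Finset.mem_image_of_mem _ (Finset.mem_range.2 (by omega)))
  have hzO : ∀ w, z w ∉ O := by
    intro w hw
    have := hOm _ hw
    simp only [hz] at this
    omega
  have old : ∀ {A : Set ℕ} {u v : V}, G.RainbowReach c S A u v → G.RainbowReach c' Set.univ A u v :=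
    fun h => h.of_agree (Set.subset_univ _) hold
  have step : ∀ w ∉ S, G.RainbowReach c' Set.univ {z w} w (a w) := by
    intro w hw
    refine .of_adj (hwa w hw) trivial trivial ?_
    rw [hcol w hw _ (ha w hw), hF]
    simp [hab w hw]
  have mixed : ∀ w ∉ S, ∀ u ∈ S, G.RainbowReach c' Set.univ O' w u := fun w hw u hu =>
    (step w hw).trans (old (M.reach _ (ha w hw) u hu)) (by simpa using hzO w)
      (by simpa using hzO' w hw) hOO'
  have pair : ∀ w ∉ S, ∀ w' ∉ S, idx w % 2 = 0 → idx w + 1 = idx w' →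
      G.RainbowReach c' Set.univ O' w w' := by
    intro w hw w' hw' h2 hidx
    obtain ⟨v, hv, hwv, hreach⟩ := hpair w' hw' w hw hidx
    have h1 : G.RainbowReach c' Set.univ {z w} w v := by
      refine .of_adj hwv trivial trivial ?_
      rw [hcol w hw v hv, hF]
      simp [h2]
    have h3 : G.RainbowReach c' Set.univ {α w'} (b w') w' := by
      refine .symm <| .of_adj (hwb w' hw') trivial trivial ?_
      rw [hcol w' hw' _ (hb w' hw'), hF]
      simp [show idx w' % 2 = 1 by omega]
    have h4 : G.RainbowReach c' Set.univ O v w' :=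
      (old hreach).trans h3 (by simp) Set.sdiff_subset (by simpa using hα w' hw')
    exact h1.trans h4 (by simpa using hzO w) (by simpa using hzO' w hw) hOO'
  refine ⟨c', O', fun u v => ?_, ?_⟩
  · by_cases hu : u ∈ S <;> by_cases hv : v ∈ S
    · exact (old (M.reach u hu v hv)).mono hOO'
    · exact (mixed v hv u hu).symm
    · exact mixed u hu v hv
    by_cases huv : u = v
    · exact huv ▸ .refl trivial
    by_cases hzz : z u = z v
    · have : idx u ≠ idx v := fun h => huv (hinj u hu v hv h)
      simp only [hz] at hzz
      by_cases h2 : idx u % 2 = 0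
      · exact pair u hu v hv h2 (by omega)
      · exact (pair v hv u hu (by omega) (by omega)).symm
    · have h1 : G.RainbowReach c' Set.univ (O ∪ {z v}) (a u) v :=
        (old (M.reach _ (ha u hu) _ (ha v hv))).trans (step v hv).symm (by simpa using hzO v)
          Set.subset_union_left Set.subset_union_right
      refine (step u hu).trans h1 ?_ (by simpa using hzO' u hu) ?_
      · rw [Set.disjoint_singleton_left]
        rintro (h | h)
        exacts [hzO u h, hzz h]
      · exact Set.union_subset hOO' (by simpa using hzO' v hv)
  · rw [hO', Finset.card_union_of_disjoint, Finset.card_image_of_injective _ (add_right_injective m),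
      Finset.card_range]
    rw [Finset.disjoint_right]
    intro o ho ho'
    obtain ⟨i, -, rfl⟩ := Finset.mem_image.1 ho
    have := hOm _ ho'
    omega

/-- `S` carries a colouring which is matched with `|S| / 2` colours, or flexible with
`(|S| + 1) / 2` colours. -/
def IsTight (G : SimpleGraph V) (S : Set V) : Prop :=
  ∃ (c : Sym2 V → ℕ) (O : Finset ℕ), G.IsMatched c S O ∧ S.ncard = 2 * O.card ∨
    G.IsFlexible c S O ∧ S.ncard + 1 = 2 * O.card

theorem IsFlexible.isTight_union [Finite V] {c : Sym2 V → ℕ} {S : Set V} {O : Finset ℕ}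
    (M : G.IsFlexible c S O) (hc : S.ncard + 1 = 2 * O.card) {x : ℕ → V} {L : ℕ}
    (H : G.IsEar S x L) : G.IsTight (S ∪ x '' Set.Ioo 0 L) := by
  have h2 := H.two_le
  have hcard := H.ncard_union
  rcases Nat.even_or_odd L with ⟨q, hq⟩ | ⟨q, hq⟩
  · have hne : x 0 ≠ x L := fun h => by
      have := H.inj 0 (by omega) L le_rfl h
      omega
    obtain ⟨α, hα, β, hβ, hαβ, v₀, hcov⟩ := M.cover _ H.start_mem _ H.end_mem hne
    obtain ⟨c', O', f, E, hO', hf⟩ := H.exists_earColoring c O (p := q + 1) (by omega) (by omega)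
      (by omega) (fun i => if i = q - 1 then α else β)
      (fun i _ _ => by split_ifs <;> assumption) (fun i j h1 h2 h3 h4 h => by
        split_ifs at h with h5 h6 h6
        · omega
        · exact absurd h hαβ
        · exact absurd h.symm hαβ
        · omega)
    have fα : f (q + 1 - 2) = α := by
      rw [hf _ (by omega) (by omega)]
      exact if_pos (by omega)
    have fβ : f (q + 1 - 1) = β := by
      rw [hf _ (by omega) (by omega)]
      exact if_neg (by omega)
    refine ⟨c', O', .inl ⟨E.isMatched_of_odd (v₀ := v₀) (by omega) M (fα ▸ hα) (fβ ▸ hβ) ?_,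
      by omega⟩⟩
    rw [fα, fβ]
    exact hcov
  · obtain ⟨o, ho, -⟩ := M.exists_two 0
    obtain ⟨c', O', f, E, hO', -⟩ := H.exists_earColoring c O (p := q + 1) (by omega) (by omega)
      (by omega) (fun _ => o) (fun _ _ _ => ho) (by omega)
    exact ⟨c', O', .inr ⟨E.isFlexible_of_even (by omega) (by omega) M, by omega⟩⟩

theorem IsMatched.isTight_union [Finite V] {c : Sym2 V → ℕ} {S : Set V} {O : Finset ℕ}
    (M : G.IsMatched c S O) (hc : S.ncard = 2 * O.card) {x : ℕ → V} {L : ℕ}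
    (H : G.IsEar S x L) (h3 : 3 ≤ L) : G.IsTight (S ∪ x '' Set.Ioo 0 L) := by
  have hcard := H.ncard_union
  obtain ⟨o, ho⟩ := M.nonempty
  rcases Nat.even_or_odd L with ⟨q, hq⟩ | ⟨q, hq⟩
  · obtain ⟨c', O', f, E, hO', -⟩ := H.exists_earColoring c O (p := q) (by omega) (by omega)
      (by omega) (fun _ => o) (fun _ _ _ => ho) (by omega)
    exact ⟨c', O', .inr ⟨E.isFlexible_of_odd (by omega) (by omega) M, by omega⟩⟩
  · obtain ⟨c', O', f, E, hO', -⟩ := H.exists_earColoring c O (p := q + 1) (by omega) (by omega)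
      (by omega) (fun _ => o) (fun _ _ _ => ho) (by omega)
    exact ⟨c', O', .inl ⟨E.isMatched_of_even (by omega) (by omega) M, by omega⟩⟩

theorem Adj.isTight_pair {a b : V} (h : G.Adj a b) : G.IsTight {a, b} := by
  have hr : ∀ u ∈ ({a, b} : Set V), ∀ v ∈ ({a, b} : Set V),
      G.RainbowReach (fun _ => 0) {a, b} (({0} : Finset ℕ) : Set ℕ) u v := by
    rintro u (rfl | rfl) v (rfl | rfl)
    · exact .refl (by simp)
    · exact .of_adj h (by simp) (by simp) (by simp)
    · exact .symm <| .of_adj h (by simp) (by simp) (by simp)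
    · exact .refl (by simp)
  have hN : ∀ u ∈ ({a, b} : Set V), G.NonFull (fun _ => 0) {a, b} (({0} : Finset ℕ) : Set ℕ) u u :=
    fun u hu => ⟨0, by simp, .refl hu⟩
  refine ⟨fun _ => 0, {0}, .inl ⟨⟨by simp, hr, ?_⟩, ?_⟩⟩
  · intro u hu v hv w hw h1 h2
    have huv : u ≠ v := fun e => h1 (e ▸ hN u hu)
    have huw : u ≠ w := fun e => h2 (e ▸ hN u hu)
    simp only [Set.mem_insert_iff, Set.mem_singleton_iff] at hu hv hw
    grind
  · rw [Set.ncard_pair h.ne]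
    simp

theorem IsTight.exists_reach [Finite V] (hG : G.IsTwoConnected) {S : Set V} (hS : G.IsTight S)
    {a b : V} (ha : a ∈ S) (hb : b ∈ S) (hab : a ≠ b) :
    ∃ (c : Sym2 V → ℕ) (O : Finset ℕ), (∀ u v, G.RainbowReach c Set.univ O u v) ∧
      O.card ≤ (Nat.card V + 1) / 2 := by
  induction hm : Sᶜ.ncard using Nat.strong_induction_on generalizing S with
  | _ m ih =>
  have hadd := Set.ncard_add_ncard_compl S
  have next : ∀ x L, G.IsEar S x L → G.IsTight (S ∪ x '' Set.Ioo 0 L) →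
      ∃ (c : Sym2 V → ℕ) (O : Finset ℕ), (∀ u v, G.RainbowReach c Set.univ O u v) ∧
      O.card ≤ (Nat.card V + 1) / 2 := by
    intro x L H hT
    have h1 := H.ncard_union
    have h2 := Set.ncard_add_ncard_compl (S ∪ x '' Set.Ioo 0 L)
    have h3 := H.two_le
    exact ih _ (by omega) hT (.inl ha) (.inl hb) rfl
  obtain ⟨c, O, ⟨M, hc⟩ | ⟨M, hc⟩⟩ := hS
  · by_cases h : ∃ x L, G.IsEar S x L ∧ 3 ≤ L
    · obtain ⟨x, L, H, h3⟩ := h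
      exact next x L H (M.isTight_union hc H h3)
    · push Not at h
      obtain ⟨c', O', h1, h2⟩ := M.exists_reach fun w hw =>
        hG.exists_two_neighbors ha hb hab (fun x L H => Nat.le_of_lt_succ (h x L H)) hw
      exact ⟨c', O', h1, by omega⟩
  · by_cases h : ∃ v, v ∉ S
    · obtain ⟨v, hv⟩ := h
      obtain ⟨x, L, H⟩ := hG.exists_isEar ha hb hab hv
      exact next x L H (M.isTight_union hc H)
    · push Not at h
      obtain rfl : S = Set.univ := Set.eq_univ_of_forall h
      exact ⟨c, O, fun u v => (M.nonFull u trivial v trivial).reach, by omega⟩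

theorem rainbowConnectionNumber_le_of_reach {c : Sym2 V → ℕ} {O : Finset ℕ} {k : ℕ} (hk : 0 < k)
    (h : ∀ u v, G.RainbowReach c Set.univ O u v) (hO : O.card ≤ k) :
    G.rainbowConnectionNumber ≤ k := by
  classical
  have : Nonempty (Fin k) := ⟨⟨0, hk⟩⟩
  obtain ⟨φ, hφ⟩ : ∃ φ : ℕ → Fin k, Set.InjOn φ O := by
    refine ⟨fun n => if h : n ∈ O then Fin.castLE hO (O.equivFin ⟨n, h⟩)
      else Classical.arbitrary _, fun x hx y hy hxy => ?_⟩
    have hx : x ∈ O := hx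
    have hy : y ∈ O := hy
    simp only [dif_pos hx, dif_pos hy] at hxy
    exact congrArg Subtype.val (O.equivFin.injective (Fin.castLE_injective hO hxy))
  refine iInf₂_le k ⟨fun e => φ (c e), fun u v => ?_⟩
  obtain ⟨p, -, hnd, hc⟩ := h u v
  have hsub := p.edges_bypass_subset_edges
  refine ⟨p.bypass, p.bypass_isPath, fun e f he hf hef => ?_⟩
  have := hφ (hc _ (hsub he)) (hc _ (hsub hf)) hef
  exact Subtype.ext (List.inj_on_of_nodup_map hnd (hsub he) (hsub hf) this)

theorem IsTwoConnected.rainbowConnectionNumber_le [Finite V] (hG : G.IsTwoConnected) :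
    G.rainbowConnectionNumber ≤ ((Nat.card V + 1) / 2 : ℕ) := by
  have hV : 3 ≤ Nat.card V := by
    have := hG.three_le_card
    rw [ENat.card_eq_coe_natCard] at this
    exact_mod_cast this
  have : Nontrivial V := (Finite.one_lt_card_iff_nontrivial).1 (by omega)
  obtain ⟨a⟩ := hG.connected.nonempty
  obtain ⟨b, hab⟩ := hG.connected.preconnected.exists_adj_of_nontrivial a
  obtain ⟨c, O, h1, h2⟩ := hab.isTight_pair.exists_reach hG (.inl rfl) (.inr rfl) hab.ne
  exact rainbowConnectionNumber_le_of_reach (by omega) h1 h2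

section CycleGraph

open scoped Fin.NatCast Fin.CommRing

variable {N : ℕ}

theorem cycleGraph_adj_natCast_succ (i : ℕ) :
    (cycleGraph (N + 2)).Adj (i : Fin (N + 2)) ((i + 1 : ℕ) : Fin (N + 2)) := by
  rw [cycleGraph_adj]
  right
  push_cast
  ring

theorem natCast_fin_inj {i j : ℕ} (hij : i ≤ j) (hj : j < i + (N + 2))
    (h : (i : Fin (N + 2)) = (j : Fin (N + 2))) : i = j := by
  have h' : i ≡ j [MOD (N + 2)] := by
    have := congrArg Fin.val h
    rwa [Fin.val_natCast, Fin.val_natCast] at this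
  have := Nat.eq_zero_of_dvd_of_lt ((Nat.modEq_iff_dvd' hij).1 h') (by omega)
  omega

/-- The edge of the cycle between the `i`-th vertex and the next one. -/
def cycleGraphEdge (N i : ℕ) : (cycleGraph (N + 2)).edgeSet :=
  ⟨s((i : Fin (N + 2)), ((i + 1 : ℕ) : Fin (N + 2))), cycleGraph_adj_natCast_succ i⟩

theorem cycleGraphEdge_add (i : ℕ) : cycleGraphEdge N (i + (N + 2)) = cycleGraphEdge N i := by
  have h : ((N + 2 : ℕ) : Fin (N + 2)) = 0 := by simp
  have h1 : ((i + (N + 2) : ℕ) : Fin (N + 2)) = (i : Fin (N + 2)) := by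
    rw [Nat.cast_add, h, add_zero]
  have h2 : ((i + (N + 2) + 1 : ℕ) : Fin (N + 2)) = ((i + 1 : ℕ) : Fin (N + 2)) := by
    rw [Nat.cast_add, h1, Nat.cast_add]
  exact Subtype.ext (by simp only [cycleGraphEdge, h1, h2])

theorem cycleGraphEdge_inj (hN : 0 < N) {i j : ℕ} (hij : i ≤ j) (hj : j < i + (N + 2))
    (h : cycleGraphEdge N i = cycleGraphEdge N j) : i = j := by
  rcases Sym2.eq_iff.1 (congrArg Subtype.val h) with ⟨h, -⟩ | ⟨h, h'⟩
  · exact natCast_fin_inj hij hj h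
  · by_cases hi : i = j
    · exact hi
    have h1 := natCast_fin_inj (by omega) (by omega) h'
    by_cases hj' : j + 1 < i + (N + 2)
    · have := natCast_fin_inj (by omega) hj' h
      omega
    · omega

/-- A walk in a cycle from the `i`-th to the `m`-th vertex contains all edges of one of the two
arcs between them. -/
theorem cycleGraph_walk_edges {i m : ℕ}
    (p : (cycleGraph (N + 2)).Walk (i : Fin (N + 2)) (m : Fin (N + 2))) :
    (∀ a, i ≤ a → a < m → (cycleGraphEdge N a : Sym2 (Fin (N + 2))) ∈ p.edges) ∨
    ∀ b, m ≤ b → b < i + (N + 2) → (cycleGraphEdge N b : Sym2 (Fin (N + 2))) ∈ p.edges := by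
  by_contra! h
  obtain ⟨⟨a, hia, ham, ha⟩, b, hmb, hb, hb'⟩ := h
  obtain ⟨d, hd, h1, h2⟩ := p.exists_boundary_dart
    {w | ∃ t : ℕ, a < t ∧ t ≤ b ∧ w = (t : Fin (N + 2))}ᶜ (by
      rintro ⟨t, hat, htb, h⟩
      have := natCast_fin_inj (by omega) (by omega) h
      omega) (fun h => h ⟨m, ham, hmb, rfl⟩)
  have hde : s(d.fst, d.snd) ∈ p.edges := by
    rw [Walk.edges, List.mem_map]
    exact ⟨d, hd, rfl⟩
  simp only [Set.mem_compl_iff, not_not] at h1 h2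
  obtain ⟨t, hat, htb, ht⟩ := h2
  have hadj := d.adj
  rw [cycleGraph_adj] at hadj
  rcases hadj with h | h
  · have hf : d.fst = ((t + 1 : ℕ) : Fin (N + 2)) := by
      rw [sub_eq_iff_eq_add.1 h, ht]
      push_cast
      ring
    by_cases htb' : t = b
    · rw [hf, ht, htb', Sym2.eq_swap] at hde
      exact hb' hde
    · exact h1 ⟨t + 1, by omega, by omega, hf⟩
  · obtain ⟨t, rfl⟩ : ∃ t', t = t' + 1 := ⟨t - 1, by omega⟩
    have hf : d.fst = (t : Fin (N + 2)) := by
      have := sub_eq_iff_eq_add.1 h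
      rw [ht, Nat.cast_add, Nat.cast_one, add_comm (1 : Fin (N + 2))] at this
      exact (add_right_cancel this).symm
    by_cases hta : t = a
    · rw [hf, ht, hta] at hde
      exact ha hde
    · exact h1 ⟨t, by omega, by omega, hf⟩

theorem cycleGraph_isTwoConnected (hN : 0 < N) : (cycleGraph (N + 2)).IsTwoConnected where
  three_le_card := by
    simp only [ENat.card_eq_coe_fintype_card, Fintype.card_fin]
    exact_mod_cast (by omega : 3 ≤ N + 2)
  connected := cycleGraph_connected
  connected_delete v := by
    have hne : ∀ k : ℕ, k < N + 1 → v + 1 + (k : Fin (N + 2)) ∈ ({v}ᶜ : Set (Fin (N + 2))) := by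
      intro k hk h
      have h' : v + 1 + (k : Fin (N + 2)) = v := h
      rw [add_assoc, add_eq_left] at h'
      have := natCast_fin_inj (i := 0) (j := k + 1) (N := N) (by omega) (by omega) (by
        rw [Nat.cast_add, Nat.cast_one, add_comm (k : Fin (N + 2)), h', Nat.cast_zero])
      omega
    have key : ∀ k : ℕ, ∀ hk : k < N + 1, ((cycleGraph (N + 2)).induce {v}ᶜ).Reachable
        ⟨_, hne 0 (by omega)⟩ ⟨_, hne k hk⟩ := by
      intro k
      induction k with
      | zero => exact fun _ => .refl _
      | succ k ih =>
        intro hk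
        refine (ih (by omega)).trans (Adj.reachable ?_)
        change (cycleGraph (N + 2)).Adj (v + 1 + (k : Fin (N + 2)))
          (v + 1 + ((k + 1 : ℕ) : Fin (N + 2)))
        rw [cycleGraph_adj]
        right
        push_cast
        ring
    have all : ∀ w : ({v}ᶜ : Set (Fin (N + 2))), ((cycleGraph (N + 2)).induce {v}ᶜ).Reachable
        ⟨_, hne 0 (by omega)⟩ w := by
      rintro ⟨w, hw⟩
      have hval : ((w - (v + 1)).val : Fin (N + 2)) = w - (v + 1) := Fin.cast_val_eq_self _
      have hlt : (w - (v + 1)).val < N + 1 := by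
        refine lt_of_le_of_ne (Nat.lt_succ_iff.1 (w - (v + 1)).2) fun h => hw ?_
        rw [h] at hval
        have h0 : ((N + 1 : ℕ) : Fin (N + 2)) + 1 = 0 := by
          rw [← Nat.cast_succ]
          simp
        have : w = v + (((N + 1 : ℕ) : Fin (N + 2)) + 1) := by
          rw [hval]
          ring
        rw [this, h0, add_zero]
        rfl
      have := key _ hlt
      simp only [hval, add_sub_cancel] at this
      exact this
    exact (connected_iff _).2 ⟨fun u w => (all u).symm.trans (all w), ⟨⟨_, hne 0 (by omega)⟩⟩⟩

theorem le_rainbowConnectionNumber_cycleGraph {r : ℕ} (hr : 2 ≤ r) :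
    ((r + 1 : ℕ) : ℕ∞) ≤ (cycleGraph (2 * r + 1)).rainbowConnectionNumber := by
  obtain ⟨N, hN⟩ : ∃ N, 2 * r + 1 = N + 2 := ⟨2 * r - 1, by omega⟩
  rw [hN]
  refine le_iInf₂ fun k ⟨c, hc⟩ => ?_
  by_contra hk
  have hk : k ≤ r := by
    have : k < r + 1 := by exact_mod_cast not_le.1 hk
    omega
  set d : ℕ → Fin k := fun i => c (cycleGraphEdge N i) with hd
  have pigeon : ∀ i, ∃ x y, i ≤ x ∧ x < y ∧ y ≤ i + r ∧ d x = d y := by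
    intro i
    obtain ⟨x, hx, y, hy, hne, h⟩ := Finset.exists_ne_map_eq_of_card_lt_of_maps_to
      (s := Finset.Icc i (i + r)) (t := Finset.univ) (f := d)
      (by rw [Finset.card_univ, Fintype.card_fin, Nat.card_Icc]; omega) (fun _ _ => by simp)
    rw [Finset.mem_Icc] at hx hy
    rcases lt_or_gt_of_ne hne with h' | h'
    exacts [⟨x, y, hx.1, h', hy.2, h⟩, ⟨y, x, hy.1, h', hx.2, h.symm⟩]
  have window : ∀ i x y, i ≤ x → x < y → y < i + r → d x ≠ d y := by
    intro i x y hix hxy hyi h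
    obtain ⟨p, -, hp⟩ := hc (i : Fin (N + 2)) ((i + r : ℕ) : Fin (N + 2))
    rcases cycleGraph_walk_edges p with h1 | h1
    · have := cycleGraphEdge_inj (by omega) hxy.le (by omega)
        (hp _ _ (h1 x hix (by omega)) (h1 y (by omega) hyi) h)
      omega
    · obtain ⟨x', y', hx', hxy', hy', h'⟩ := pigeon (i + r)
      have := cycleGraphEdge_inj (by omega) hxy'.le (by omega)
        (hp _ _ (h1 x' hx' (by omega)) (h1 y' (by omega) (by omega)) h')
      omega
  have shift : ∀ i, d (i + r) = d i := by
    intro i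
    obtain ⟨x, y, hx, hxy, hy, h⟩ := pigeon i
    by_cases hxi : x = i
    · by_cases hyi : y = i + r
      · rw [hxi, hyi] at h
        exact h.symm
      · exact absurd h (window i x y hx hxy (by omega))
    · exact absurd h (window (i + 1) x y (by omega) hxy (by omega))
  have h1 : d (1 + r + r) = d 1 := by rw [shift, shift]
  have h2 : d (1 + r + r) = d 0 := by
    rw [hd]
    simp only
    rw [show 1 + r + r = 0 + (N + 2) by omega, cycleGraphEdge_add]
  exact window 0 0 1 le_rfl one_pos (by omega) (h2.symm.trans h1)

end CycleGraph

theorem natCeil_half (n : ℕ) : ⌈(n : ℚ) / 2⌉₊ = (n + 1) / 2 := by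
  rcases Nat.even_or_odd' n with ⟨m, rfl | rfl⟩
  · rw [show (2 * m + 1) / 2 = m by omega, Nat.cast_mul, Nat.cast_ofNat,
      mul_div_cancel_left₀ _ two_ne_zero, Nat.ceil_natCast]
  · rw [show (2 * m + 1 + 1) / 2 = m + 1 by omega, Nat.ceil_eq_iff (by omega)]
    push_cast
    constructor <;> linarith

end SimpleGraph

theorem theorem2 :
    (∀ (V : Type*) [Finite V] (G : SimpleGraph V), G.IsTwoConnected →
      G.rainbowConnectionNumber ≤ (⌈(Nat.card V : ℚ) / 2⌉₊ : ℕ∞)) ∧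
    (∀ n : ℕ, Odd n → 5 ≤ n →
      (SimpleGraph.cycleGraph n).rainbowConnectionNumber = (⌈(n : ℚ) / 2⌉₊ : ℕ∞)) := by
  refine ⟨fun V _ G hG => ?_, fun n hn h5 => ?_⟩
  · rw [SimpleGraph.natCeil_half]
    exact hG.rainbowConnectionNumber_le
  · rw [SimpleGraph.natCeil_half]
    obtain ⟨r, rfl⟩ := hn
    refine le_antisymm ?_ ?_
    · have := (SimpleGraph.cycleGraph_isTwoConnected (N := 2 * r - 1)
        (by omega)).rainbowConnectionNumber_le
      rwa [show 2 * r - 1 + 2 = 2 * r + 1 by omega, Nat.card_fin] at this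
    · rw [show (2 * r + 1 + 1) / 2 = r + 1 by omega]
      exact SimpleGraph.le_rainbowConnectionNumber_cycleGraph (by omega)
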